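/- Write $\mathcal L(\mathbb C^n)$ for the linear operators on $\mathbb C^n$. A linear map between such spaces is positive if it maps positive operators to positive operators; a channel (Heisenberg picture) is a linear map that is unit-preserving and completely positive. For $0\le\eta\le1$ let $\Lambda_\eta:\mathcal L(\mathbb C^2)\to\mathcal L(\mathbb C^2)$, $\Lambda_\eta(A)=\eta A+\frac{1-\eta}{2}\operatorname{tr}[A]\,1$, be the noisy identity channel on a qubit. A linear map $\Lambda$ on $\mathcal L(\mathbb C^2\otimes\mathbb C^2)$ has marginals $\Lambda_{\eta_1},\Lambda_{\eta_2}$ if $\Lambda(X\otimes1)=\Lambda_{\eta_1}(X)$ and $\Lambda(1\otimes Y)=\Lambda_{\eta_2}(Y)$ for all $X,Y\in\mathcal L(\mathbb C^2)$. The pair $(\Lambda_{\eta_1},\Lambda_{\eta_2})$ is - quantum compatible if some channel $\Lambda:\mathcal L(\mathbb C^2\otimes\mathbb C^2)\to\mathcal L(\mathbb C^2)$ has these marginals; - min-tensor-compatible if some linear map $\Lambda:\mathcal L(\mathbb C^2\otimes\mathbb C^2)\to\mathcal L(\mathbb C^2)$ with these marginals (a joint map) sends every finite sum $\sum_n\lambda_nF_n\otimes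 G_n$ with $\lambda_n\ge0$ and $F_n,G_n$ positive to a positive operator; - almost quantum compatible if it is min-tensor-compatible and has a joint map of the form $\Lambda=\Psi\circ(\Theta_1\otimes\Theta_2)$ with $\Psi:\mathcal L(\mathbb C^2\otimes\mathbb C^2)\to\mathcal L(\mathbb C^2)$ a channel and $\Theta_1,\Theta_2:\mathcal L(\mathbb C^2)\to\mathcal L(\mathbb C^2)$ positive maps. Theorem 2. For all $\eta_1,\eta_2\in[0,1]$, $\Lambda_{\eta_1}$ and $\Lambda_{\eta_2}$ are almost quantum compatible if and only if $$\eta_1^2+\eta_2^2+(1-\eta_1-\eta_2)^2\le1.$$ Moreover, for all $\eta_1,\eta_2\in[0,1]$ they are almost quantum compatible if and only if they are quantum compatible, and the set of $(\eta_1,\eta_2)\in[0,1]^2$ for which they are almost quantum compatible is a proper subset of the set of those for which they are min-tensor-compatible. -/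

import Mathlib

open scoped Kronecker ComplexOrder

noncomputable section

namespace QChannel

/-- Operators on the finite-dimensional Hilbert space `ℂⁿ`, with `n` a finite index type.
`ℂᵐ ⊗ ℂⁿ` is `ℂ^(m × n)`, and the tensor product of operators is the Kronecker product. -/
abbrev Op (n : Type) : Type := Matrix n n ℂ

/-- The tensor product `Θ₁ ⊗ Θ₂` of linear maps between operator spaces, given on matrix units
(see `tensorMap_kronecker`). -/
def tensorMap {m n p q : Type} [Fintype m] [Fintype n] [DecidableEq m] [DecidableEq n]
    (Θ₁ : Op m →ₗ[ℂ] Op p) (Θ₂ : Op n →ₗ[ℂ] Op q) : Op (m × n) →ₗ[ℂ] Op (p × q) where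
  toFun X := ∑ i : m, ∑ j : m, ∑ k : n, ∑ l : n,
    X (i, k) (j, l) • (Θ₁ (Matrix.single i j 1) ⊗ₖ Θ₂ (Matrix.single k l 1))
  map_add' X Y := by
    simp only [Matrix.add_apply, add_smul, Finset.sum_add_distrib]
  map_smul' c X := by
    simp only [Matrix.smul_apply, smul_eq_mul, mul_smul, Finset.smul_sum, RingHom.id_apply]

/-- `tensorMap Θ₁ Θ₂` is the linear map sending `A ⊗ B` to `Θ₁ A ⊗ Θ₂ B`. -/
theorem tensorMap_kronecker {m n p q : Type} [Fintype m] [Fintype n] [DecidableEq m]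
    [DecidableEq n] (Θ₁ : Op m →ₗ[ℂ] Op p) (Θ₂ : Op n →ₗ[ℂ] Op q) (A : Op m) (B : Op n) :
    tensorMap Θ₁ Θ₂ (A ⊗ₖ B) = Θ₁ A ⊗ₖ Θ₂ B := by
  have key : ∀ {r s : Type} [Fintype r] [DecidableEq r] (Θ : Op r →ₗ[ℂ] Op s) (C : Op r),
      Θ C = ∑ i : r, ∑ j : r, C i j • Θ (Matrix.single i j 1) := by
    intro r s _ _ Θ C
    conv_lhs => rw [Matrix.matrix_eq_sum_single C]
    rw [map_sum]
    refine Finset.sum_congr rfl fun i _ => ?_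
    rw [map_sum]
    refine Finset.sum_congr rfl fun j _ => ?_
    rw [← Θ.map_smul, Matrix.smul_single, smul_eq_mul, mul_one]
  rw [key Θ₁ A, key Θ₂ B]
  ext ⟨a, b⟩ ⟨c, d⟩
  simp only [tensorMap, LinearMap.coe_mk, AddHom.coe_mk, Matrix.sum_apply, Matrix.smul_apply,
    Matrix.kronecker_apply, smul_eq_mul]
  simp only [Finset.sum_mul]
  simp only [Finset.mul_sum]
  refine Finset.sum_congr rfl fun i _ => ?_
  refine Finset.sum_congr rfl fun j _ => ?_
  refine Finset.sum_congr rfl fun k _ => ?_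
  refine Finset.sum_congr rfl fun l _ => ?_
  ring

/-- A positive map: it sends positive operators to positive operators. -/
def IsPositiveMap {m p : Type} [Fintype m] [Fintype p] (Θ : Op m →ₗ[ℂ] Op p) : Prop :=
  ∀ X : Op m, X.PosSemidef → (Θ X).PosSemidef

/-- Complete positivity: `Λ ⊗ id` is positive on `L(ℂᵐ) ⊗ L(ℂᵈ)` for every `d`. -/
def IsCompletelyPositive {m p : Type} [Fintype m] [DecidableEq m] [Fintype p]
    (Λ : Op m →ₗ[ℂ] Op p) : Prop :=
  ∀ d : ℕ, IsPositiveMap (tensorMap Λ (LinearMap.id : Op (Fin d) →ₗ[ℂ] Op (Fin d)))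

/-- A channel (Heisenberg picture): a unit-preserving completely positive linear map. -/
def IsChannel {m p : Type} [Fintype m] [DecidableEq m] [Fintype p] [DecidableEq p]
    (Λ : Op m →ₗ[ℂ] Op p) : Prop :=
  Λ 1 = 1 ∧ IsCompletelyPositive Λ

/-- `Λ(X ⊗ 1) = Λ₁(X)` and `Λ(1 ⊗ Y) = Λ₂(Y)`. -/
def HasMarginals {a b c : Type} [DecidableEq b] [DecidableEq c]
    (Λ : Op (b × c) →ₗ[ℂ] Op a) (Λ₁ : Op b →ₗ[ℂ] Op a) (Λ₂ : Op c →ₗ[ℂ] Op a) : Prop :=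
  (∀ X : Op b, Λ (X ⊗ₖ (1 : Op c)) = Λ₁ X) ∧ (∀ Y : Op c, Λ ((1 : Op b) ⊗ₖ Y) = Λ₂ Y)

/-- Quantum compatibility: there is a joint channel. -/
def QuantumCompatible {a b c : Type} [Fintype a] [DecidableEq a] [Fintype b] [DecidableEq b]
    [Fintype c] [DecidableEq c] (Λ₁ : Op b →ₗ[ℂ] Op a) (Λ₂ : Op c →ₗ[ℂ] Op a) : Prop :=
  ∃ Λ : Op (b × c) →ₗ[ℂ] Op a, IsChannel Λ ∧ HasMarginals Λ Λ₁ Λ₂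

/-- The minimal tensor cone `L₊(ℂᵇ) ⊗_min L₊(ℂᶜ)`: the finite sums `∑ₙ λₙ Fₙ ⊗ Gₙ` with
`λₙ ≥ 0` and `Fₙ`, `Gₙ` positive. -/
def minTensorCone (b c : Type) [Fintype b] [Fintype c] : Set (Op (b × c)) :=
  {E | E.PosSemidef ∧ ∃ (N : ℕ) (w : Fin N → ℝ) (F : Fin N → Op b) (G : Fin N → Op c),
    (∀ n, 0 ≤ w n) ∧ (∀ n, (F n).PosSemidef) ∧ (∀ n, (G n).PosSemidef) ∧
    E = ∑ n, (w n : ℂ) • (F n ⊗ₖ G n)}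

/-- `Λ` is a joint map of `Λ₁` and `Λ₂` for the composite system with positive cone `P`. -/
def IsJointMap {a b c : Type} [Fintype a] [DecidableEq b] [DecidableEq c]
    (P : Set (Op (b × c))) (Λ₁ : Op b →ₗ[ℂ] Op a) (Λ₂ : Op c →ₗ[ℂ] Op a)
    (Λ : Op (b × c) →ₗ[ℂ] Op a) : Prop :=
  (∀ E ∈ P, (Λ E).PosSemidef) ∧ HasMarginals Λ Λ₁ Λ₂

/-- Min-tensor-compatibility. -/
def MinTensorCompatible {a b c : Type} [Fintype a] [Fintype b] [DecidableEq b]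
    [Fintype c] [DecidableEq c] (Λ₁ : Op b →ₗ[ℂ] Op a) (Λ₂ : Op c →ₗ[ℂ] Op a) : Prop :=
  ∃ Λ : Op (b × c) →ₗ[ℂ] Op a, IsJointMap (minTensorCone b c) Λ₁ Λ₂ Λ

/-- Almost quantum compatibility: min-tensor-compatible, with a joint map of the form
`Ψ ∘ (Θ₁ ⊗ Θ₂)`, where `Ψ` is a channel and `Θ₁`, `Θ₂` are positive maps. -/
def AlmostQuantumCompatible {a b c : Type} [Fintype a] [DecidableEq a] [Fintype b]
    [DecidableEq b] [Fintype c] [DecidableEq c]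
    (Λ₁ : Op b →ₗ[ℂ] Op a) (Λ₂ : Op c →ₗ[ℂ] Op a) : Prop :=
  MinTensorCompatible Λ₁ Λ₂ ∧
  ∃ (Ψ : Op (b × c) →ₗ[ℂ] Op a) (Θ₁ : Op b →ₗ[ℂ] Op b) (Θ₂ : Op c →ₗ[ℂ] Op c),
    IsChannel Ψ ∧ IsPositiveMap Θ₁ ∧ IsPositiveMap Θ₂ ∧
    IsJointMap (minTensorCone b c) Λ₁ Λ₂ (Ψ ∘ₗ tensorMap Θ₁ Θ₂)

/-- The noisy identity channel on a qubit, `Λ_η(A) = η A + ((1 - η)/2) tr[A] 1`. -/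
def noisyId (η : ℝ) : Op (Fin 2) →ₗ[ℂ] Op (Fin 2) where
  toFun A := (η : ℂ) • A + (((1 - η : ℝ) : ℂ) / 2 * A.trace) • (1 : Op (Fin 2))
  map_add' A B := by
    simp only [Matrix.trace_add, smul_add, mul_add, add_smul]; abel
  map_smul' c A := by
    simp only [Matrix.trace_smul, smul_eq_mul, RingHom.id_apply, smul_add, smul_smul]
    congr 2 <;> ring

end QChannel

end

open scoped Kronecker ComplexOrder

noncomputable section

namespace QChannel

/-! Quantum compatibility trivially gives almost quantum compatibility, so equality of the two
regions needs a construction inside the ellipse and an obstruction outside it.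

Inside, asymmetric cloning works: `covariantJointMap` with `h = 0` has coefficients `p = (1 -
η₂)/2`, `q = (1 - η₁)/2`, `g = (η₁ + η₂ - 1)/2`, and has a Kraus form as soon as `g² ≤ p q`, which
is exactly the inequality of the theorem (`quantumCompatible_noisyId_of_le`).

Outside, the point is that positive qubit maps are decomposable
(`IsPositiveMap.mem_decomposableMaps`). Hence `Θ₁ ⊗ Θ₂ ⊗ id` keeps positive any operator all of
whose partial transposes on the first two factors are positive. `pairWitness` with constant `c₁ + c₂
+ s`, `s² = c₁² + c₂² - c₁c₂`, is such an operator (`posSemidef_pairWitness`). Applying the joint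
map to it and pairing with a maximally entangled vector yields an inequality linear in `η₁, η₂`
(`marginal_bound`). These are tangent lines of the ellipse, and the right choice of `c₁, c₂`
excludes any given outside point.

Decomposability is proved by subtracting the largest admissible multiple of `X ↦ tr[X] 1`, which
creates a zero on a pair of product vectors. With such a zero the map is rigid enough for explicit
Kraus operators (`mem_decomposableMaps_of_zero`, resting on `exists_kraus_of_forall_normSq_le`).

Strictness comes from `η₁ = η₂ = 7/10`, where a covariant map is positive on products by a Bloch
vector estimate (`bloch_inequality`). -/

/-! ### Linear maps on operator spaces -/

/-- A linear map on operators on a tensor product is determined by its values on the products. -/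
theorem linearMap_ext_kronecker {m n p : Type} [Fintype m] [Fintype n] [DecidableEq m]
    [DecidableEq n] {f g : Op (m × n) →ₗ[ℂ] Op p}
    (h : ∀ (A : Op m) (B : Op n), f (A ⊗ₖ B) = g (A ⊗ₖ B)) : f = g := by
  refine Matrix.ext_linearMap ℂ fun i j => LinearMap.ext_ring ?_
  have : (Matrix.single i j 1 : Op (m × n)) =
      Matrix.single i.1 j.1 1 ⊗ₖ Matrix.single i.2 j.2 1 := by
    rw [Matrix.single_kronecker_single, one_mul]
  simp only [LinearMap.comp_apply, Matrix.singleLinearMap_apply]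
  rw [this, h]

theorem tensorMap_comp {m n p q r s : Type} [Fintype m] [Fintype n] [DecidableEq m]
    [DecidableEq n] [Fintype p] [Fintype q] [DecidableEq p] [DecidableEq q]
    (f : Op p →ₗ[ℂ] Op r) (g : Op q →ₗ[ℂ] Op s) (f' : Op m →ₗ[ℂ] Op p) (g' : Op n →ₗ[ℂ] Op q) :
    tensorMap (f ∘ₗ f') (g ∘ₗ g') = tensorMap f g ∘ₗ tensorMap f' g' := by
  refine linearMap_ext_kronecker fun A B => ?_
  simp only [LinearMap.comp_apply, tensorMap_kronecker]

theorem tensorMap_id {m n : Type} [Fintype m] [Fintype n] [DecidableEq m] [DecidableEq n] :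
    tensorMap (LinearMap.id : Op m →ₗ[ℂ] Op m) (LinearMap.id : Op n →ₗ[ℂ] Op n) =
      LinearMap.id := by
  refine linearMap_ext_kronecker fun A B => ?_
  simp only [LinearMap.id_apply, tensorMap_kronecker]

theorem tensorMap_add_left {m n p q : Type} [Fintype m] [Fintype n] [DecidableEq m]
    [DecidableEq n] (f f' : Op m →ₗ[ℂ] Op p) (g : Op n →ₗ[ℂ] Op q) :
    tensorMap (f + f') g = tensorMap f g + tensorMap f' g := by
  refine linearMap_ext_kronecker fun A B => ?_
  simp only [LinearMap.add_apply, tensorMap_kronecker, Matrix.add_kronecker]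

theorem tensorMap_add_right {m n p q : Type} [Fintype m] [Fintype n] [DecidableEq m]
    [DecidableEq n] (f : Op m →ₗ[ℂ] Op p) (g g' : Op n →ₗ[ℂ] Op q) :
    tensorMap f (g + g') = tensorMap f g + tensorMap f g' := by
  refine linearMap_ext_kronecker fun A B => ?_
  simp only [LinearMap.add_apply, tensorMap_kronecker, Matrix.kronecker_add]

theorem tensorMap_zero_left {m n p q : Type} [Fintype m] [Fintype n] [DecidableEq m]
    [DecidableEq n] (g : Op n →ₗ[ℂ] Op q) :
    tensorMap (0 : Op m →ₗ[ℂ] Op p) g = 0 := by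
  refine linearMap_ext_kronecker fun A B => ?_
  simp only [LinearMap.zero_apply, tensorMap_kronecker, Matrix.zero_kronecker]

theorem tensorMap_zero_right {m n p q : Type} [Fintype m] [Fintype n] [DecidableEq m]
    [DecidableEq n] (f : Op m →ₗ[ℂ] Op p) :
    tensorMap f (0 : Op n →ₗ[ℂ] Op q) = 0 := by
  refine linearMap_ext_kronecker fun A B => ?_
  simp only [LinearMap.zero_apply, tensorMap_kronecker, Matrix.kronecker_zero]

/-- The linear map `X ↦ A X Aᴴ`. -/
def conjMap {m p : Type} [Fintype m] (A : Matrix p m ℂ) : Op m →ₗ[ℂ] Op p where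
  toFun X := A * X * A.conjTranspose
  map_add' X Y := by rw [Matrix.mul_add, Matrix.add_mul]
  map_smul' c X := by rw [Matrix.mul_smul, Matrix.smul_mul, RingHom.id_apply]

theorem conjMap_apply {m p : Type} [Fintype m] (A : Matrix p m ℂ) (X : Op m) :
    conjMap A X = A * X * A.conjTranspose := rfl

/-- Transposition as a complex linear map. -/
def transposeMap (m : Type) : Op m →ₗ[ℂ] Op m where
  toFun X := X.transpose
  map_add' X Y := Matrix.transpose_add X Y
  map_smul' c X := Matrix.transpose_smul c X

theorem transposeMap_apply {m : Type} (X : Op m) : transposeMap m X = X.transpose := rfl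

theorem conjMap_comp {m n p : Type} [Fintype m] [Fintype n] (A : Matrix p n ℂ)
    (B : Matrix n m ℂ) : conjMap A ∘ₗ conjMap B = conjMap (A * B) := by
  ext1 X
  simp only [LinearMap.comp_apply, conjMap_apply, Matrix.conjTranspose_mul, Matrix.mul_assoc]

theorem conjMap_one {m : Type} [Fintype m] [DecidableEq m] :
    conjMap (1 : Op m) = LinearMap.id := by
  ext1 X
  simp [conjMap_apply]

theorem transposeMap_comp_conjMap {m p : Type} [Fintype m] (A : Matrix p m ℂ) :
    transposeMap p ∘ₗ conjMap A = conjMap (A.map star) ∘ₗ transposeMap m := by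
  ext1 X
  simp only [LinearMap.comp_apply, conjMap_apply, transposeMap_apply, Matrix.transpose_mul,
    Matrix.mul_assoc]
  congr 2
  ext i j
  simp

theorem isPositiveMap_conjMap {m p : Type} [Fintype m] [Fintype p] (A : Matrix p m ℂ) :
    IsPositiveMap (conjMap A) := fun _ hX => hX.mul_mul_conjTranspose_same A

theorem tensorMap_conjMap {m n p q : Type} [Fintype m] [Fintype n] [DecidableEq m]
    [DecidableEq n] (A : Matrix p m ℂ) (B : Matrix q n ℂ) :
    tensorMap (conjMap A) (conjMap B) = conjMap (A ⊗ₖ B) := by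
  refine linearMap_ext_kronecker fun X Y => ?_
  simp only [tensorMap_kronecker, conjMap_apply, Matrix.mul_kronecker_mul,
    Matrix.conjTranspose_kronecker]

/-! ### Completely positive maps -/

theorem IsCompletelyPositive.conjMap {m p : Type} [Fintype m] [DecidableEq m] [Fintype p]
    (A : Matrix p m ℂ) : IsCompletelyPositive (conjMap A) := by
  intro d X hX
  rw [← conjMap_one, tensorMap_conjMap]
  exact isPositiveMap_conjMap _ X hX

theorem IsCompletelyPositive.add {m p : Type} [Fintype m] [DecidableEq m] [Fintype p]
    {f g : Op m →ₗ[ℂ] Op p} (hf : IsCompletelyPositive f) (hg : IsCompletelyPositive g) :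
    IsCompletelyPositive (f + g) := by
  intro d X hX
  rw [tensorMap_add_left]
  exact (hf d X hX).add (hg d X hX)

theorem IsCompletelyPositive.isPositiveMap {m p : Type} [Fintype m] [DecidableEq m] [Fintype p]
    {f : Op m →ₗ[ℂ] Op p} (hf : IsCompletelyPositive f) : IsPositiveMap f := by
  -- A one-dimensional ancilla suffices; the submatrix identifies `Fin 2 × Fin 1`-type indices with
  -- the original ones.
  intro X hX
  have h := (hf 1 (X ⊗ₖ 1) (hX.kronecker Matrix.PosSemidef.one)).submatrix (fun i => (i, 0))
  rw [tensorMap_kronecker] at h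
  convert h using 1
  ext i j
  simp

theorem QuantumCompatible.almostQuantumCompatible {a b c : Type} [Fintype a] [DecidableEq a]
    [Fintype b] [DecidableEq b] [Fintype c] [DecidableEq c] {Λ₁ : Op b →ₗ[ℂ] Op a}
    {Λ₂ : Op c →ₗ[ℂ] Op a} (h : QuantumCompatible Λ₁ Λ₂) : AlmostQuantumCompatible Λ₁ Λ₂ := by
  obtain ⟨Λ, hΛ, hm⟩ := h
  have hJ : IsJointMap (minTensorCone b c) Λ₁ Λ₂ Λ :=
    ⟨fun E hE => hΛ.2.isPositiveMap E hE.1, hm⟩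
  refine ⟨⟨Λ, hJ⟩, Λ, LinearMap.id, LinearMap.id, hΛ, fun _ h => h, fun _ h => h, ?_⟩
  rwa [tensorMap_id, LinearMap.comp_id]

/-! ### Decomposable maps -/

/-- The decomposable maps: sums of maps `X ↦ A X Aᴴ` and `X ↦ A Xᵀ Aᴴ`. -/
def decomposableMaps (m p : Type) [Fintype m] : AddSubmonoid (Op m →ₗ[ℂ] Op p) :=
  AddSubmonoid.closure
    (Set.range conjMap ∪ Set.range fun A : Matrix p m ℂ => conjMap A ∘ₗ transposeMap m)

theorem conjMap_mem_decomposableMaps {m p : Type} [Fintype m] (A : Matrix p m ℂ) :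
    conjMap A ∈ decomposableMaps m p :=
  AddSubmonoid.subset_closure (Or.inl ⟨A, rfl⟩)

theorem conjMap_comp_transposeMap_mem_decomposableMaps {m p : Type} [Fintype m]
    (A : Matrix p m ℂ) : conjMap A ∘ₗ transposeMap m ∈ decomposableMaps m p :=
  AddSubmonoid.subset_closure (Or.inr ⟨A, rfl⟩)

theorem conjMap_comp_mem_decomposableMaps {m p q : Type} [Fintype m] [Fintype p]
    (A : Matrix q p ℂ) {f : Op m →ₗ[ℂ] Op p} (hf : f ∈ decomposableMaps m p) :
    conjMap A ∘ₗ f ∈ decomposableMaps m q := by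
  induction hf using AddSubmonoid.closure_induction with
  | mem f hf =>
    obtain ⟨B, rfl⟩ | ⟨B, rfl⟩ := hf
    · rw [conjMap_comp]
      exact conjMap_mem_decomposableMaps _
    · simp only [← LinearMap.comp_assoc, conjMap_comp]
      exact conjMap_comp_transposeMap_mem_decomposableMaps _
  | zero => simp
  | add f g _ _ hf hg =>
    rw [LinearMap.comp_add]
    exact add_mem hf hg

theorem comp_conjMap_mem_decomposableMaps {m p q : Type} [Fintype m] [Fintype p]
    {f : Op p →ₗ[ℂ] Op q} (hf : f ∈ decomposableMaps p q) (A : Matrix p m ℂ) :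
    f ∘ₗ conjMap A ∈ decomposableMaps m q := by
  induction hf using AddSubmonoid.closure_induction with
  | mem f hf =>
    obtain ⟨B, rfl⟩ | ⟨B, rfl⟩ := hf
    · rw [conjMap_comp]
      exact conjMap_mem_decomposableMaps _
    · simp only [LinearMap.comp_assoc, transposeMap_comp_conjMap]
      rw [← LinearMap.comp_assoc, conjMap_comp]
      exact conjMap_comp_transposeMap_mem_decomposableMaps _
  | zero => simp
  | add f g _ _ hf hg =>
    rw [LinearMap.add_comp]
    exact add_mem hf hg

theorem smul_mem_decomposableMaps {m p : Type} [Fintype m] [Fintype p] [DecidableEq p]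
    {f : Op m →ₗ[ℂ] Op p} (hf : f ∈ decomposableMaps m p) {c : ℝ} (hc : 0 ≤ c) :
    (c : ℂ) • f ∈ decomposableMaps m p := by
  have h := conjMap_comp_mem_decomposableMaps (((√c : ℝ) : ℂ) • (1 : Op p)) hf
  convert h using 1
  ext1 X
  simp only [LinearMap.smul_apply, LinearMap.comp_apply, conjMap_apply,
    Matrix.conjTranspose_smul, Matrix.conjTranspose_one, Matrix.smul_mul, Matrix.mul_smul,
    Matrix.one_mul, Matrix.mul_one, smul_smul]
  congr 1
  rw [Complex.star_def, Complex.conj_ofReal, ← Complex.ofReal_mul, Real.mul_self_sqrt hc]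

/-- If `Z` and its partial transposes on the first two factors are positive, then so is its image
under decomposable maps acting on these factors. -/
theorem posSemidef_tensorMap_of_decomposable {m n p q r : Type} [Fintype m] [Fintype n]
    [DecidableEq m] [DecidableEq n] [Fintype p] [Fintype q] [DecidableEq p]
    [DecidableEq q] [Fintype r] [DecidableEq r]
    {f : Op m →ₗ[ℂ] Op p} {g : Op n →ₗ[ℂ] Op q}
    (hf : f ∈ decomposableMaps m p) (hg : g ∈ decomposableMaps n q) {Z : Op ((m × n) × r)}
    (hZ : ∀ u ∈ ({LinearMap.id, transposeMap m} : Set (Op m →ₗ[ℂ] Op m)),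
      ∀ v ∈ ({LinearMap.id, transposeMap n} : Set (Op n →ₗ[ℂ] Op n)),
      (tensorMap (tensorMap u v) (LinearMap.id : Op r →ₗ[ℂ] Op r) Z).PosSemidef) :
    (tensorMap (tensorMap f g) (LinearMap.id : Op r →ₗ[ℂ] Op r) Z).PosSemidef := by
  have key : ∀ u ∈ ({LinearMap.id, transposeMap m} : Set (Op m →ₗ[ℂ] Op m)),
      ∀ v ∈ ({LinearMap.id, transposeMap n} : Set (Op n →ₗ[ℂ] Op n)),
      ∀ (A : Matrix p m ℂ) (B : Matrix q n ℂ),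
      (tensorMap (tensorMap (conjMap A ∘ₗ u) (conjMap B ∘ₗ v))
        (LinearMap.id : Op r →ₗ[ℂ] Op r) Z).PosSemidef := by
    intro u hu v hv A B
    have h : (LinearMap.id : Op r →ₗ[ℂ] Op r) = LinearMap.id ∘ₗ LinearMap.id := rfl
    rw [h, tensorMap_comp, tensorMap_comp, tensorMap_conjMap, ← conjMap_one, tensorMap_conjMap,
      conjMap_one, LinearMap.comp_apply]
    exact isPositiveMap_conjMap _ _ (hZ u hu v hv)
  have gen : ∀ {s t : Type} [Fintype s] [DecidableEq s] (f : Op s →ₗ[ℂ] Op t),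
      f ∈ Set.range conjMap ∪ Set.range (fun A : Matrix t s ℂ => conjMap A ∘ₗ transposeMap s) →
      ∃ (A : Matrix t s ℂ), ∃ u ∈ ({LinearMap.id, transposeMap s} : Set (Op s →ₗ[ℂ] Op s)),
        f = conjMap A ∘ₗ u := by
    rintro s t _ _ f (⟨A, rfl⟩ | ⟨A, rfl⟩)
    · exact ⟨A, LinearMap.id, by simp, rfl⟩
    · exact ⟨A, transposeMap s, by simp, rfl⟩
  induction hf using AddSubmonoid.closure_induction with
  | mem f hf =>
    obtain ⟨A, u, hu, rfl⟩ := gen f hf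
    induction hg using AddSubmonoid.closure_induction with
    | mem g hg =>
      obtain ⟨B, v, hv, rfl⟩ := gen g hg
      exact key u hu v hv A B
    | zero =>
      rw [tensorMap_zero_right, tensorMap_zero_left]
      exact Matrix.PosSemidef.zero
    | add g g' _ _ hg hg' =>
      rw [tensorMap_add_right, tensorMap_add_left]
      exact hg.add hg'
  | zero =>
    rw [tensorMap_zero_left, tensorMap_zero_left]
    exact Matrix.PosSemidef.zero
  | add f f' _ _ hf hf' =>
    rw [tensorMap_add_left, tensorMap_add_left]
    exact hf.add hf'

/-! ### Scalar lemmas -/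

/-- For `D > 0` both sides say `k₁²/D + k₂²/(D + g²) ≤ c`: the hypothesis by Cauchy-Schwarz, the
conclusion by minimising `(k₂ - g w)² + D w²` over `w`. The shift `w` becomes the one free parameter
in the Kraus operators. -/
theorem exists_shift_of_quadratic_le {D g c k₁ k₂ : ℝ} (hD : 0 ≤ D) (hc : 0 ≤ c)
    (h : ∀ C S : ℝ, C ^ 2 + S ^ 2 = 1 →
      (C * k₁ - S * k₂) ^ 2 ≤ c * (D * C ^ 2 + (D + g ^ 2) * S ^ 2)) :
    ∃ w : ℝ, w ^ 2 ≤ c ∧ k₁ ^ 2 + (k₂ - g * w) ^ 2 ≤ D * (c - w ^ 2) := by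
  have hom : ∀ C S : ℝ, (C * k₁ - S * k₂) ^ 2 ≤ c * (D * C ^ 2 + (D + g ^ 2) * S ^ 2) := by
    intro C S
    by_cases h0 : C ^ 2 + S ^ 2 = 0
    · have hC : C = 0 := by nlinarith [sq_nonneg C, sq_nonneg S]
      have hS : S = 0 := by nlinarith [sq_nonneg C, sq_nonneg S]
      simp [hC, hS]
    · have hp : 0 < C ^ 2 + S ^ 2 := lt_of_le_of_ne (by positivity) (Ne.symm h0)
      set n := √(C ^ 2 + S ^ 2) with hn
      have hn0 : 0 < n := Real.sqrt_pos.2 hp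
      have hn2 : n ^ 2 = C ^ 2 + S ^ 2 := Real.sq_sqrt hp.le
      have h1 := h (C / n) (S / n) (by field_simp; linarith)
      have e1 : (C / n * k₁ - S / n * k₂) ^ 2 = (C * k₁ - S * k₂) ^ 2 / n ^ 2 := by
        field_simp
      have e2 : c * (D * (C / n) ^ 2 + (D + g ^ 2) * (S / n) ^ 2) =
          c * (D * C ^ 2 + (D + g ^ 2) * S ^ 2) / n ^ 2 := by
        field_simp
      rw [e1, e2] at h1
      exact (div_le_div_iff_of_pos_right (by positivity)).1 h1
  rcases hD.eq_or_lt with rfl | hD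
  · have hk₁ : k₁ = 0 := by
      have := hom 1 0
      have : k₁ ^ 2 ≤ 0 := by linarith
      nlinarith [sq_nonneg k₁]
    have hk₂ : k₂ ^ 2 ≤ c * g ^ 2 := by linarith [hom 0 1]
    by_cases hg : g = 0
    · refine ⟨0, by simpa using hc, ?_⟩
      subst hg hk₁
      linarith
    · refine ⟨k₂ / g, ?_, ?_⟩
      · rw [div_pow, div_le_iff₀ (by positivity)]
        exact hk₂
      · rw [hk₁, mul_div_cancel₀ _ hg]
        simp
  · have hE : 0 < D + g ^ 2 := by positivity
    -- The equality case of Cauchy-Schwarz.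
    have h1 := hom (k₁ / D) (-k₂ / (D + g ^ 2))
    set q := k₁ ^ 2 / D + k₂ ^ 2 / (D + g ^ 2) with hq
    have hq0 : 0 ≤ q := by positivity
    have e1 : k₁ / D * k₁ - -k₂ / (D + g ^ 2) * k₂ = q := by rw [hq]; ring
    have e2 : D * (k₁ / D) ^ 2 + (D + g ^ 2) * (-k₂ / (D + g ^ 2)) ^ 2 = q := by
      rw [hq]; field_simp
    rw [e1, e2] at h1
    have hqc : q ≤ c := by
      rcases hq0.eq_or_lt with h0 | h0
      · rw [← h0]; exact hc
      · nlinarith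
    -- The minimiser of `(k₂ - g w)² + D w²`.
    refine ⟨g * k₂ / (D + g ^ 2), ?_, ?_⟩
    · refine le_trans ?_ hqc
      have : (g * k₂ / (D + g ^ 2)) ^ 2 = k₂ ^ 2 / (D + g ^ 2) * (g ^ 2 / (D + g ^ 2)) := by
        field_simp
      rw [this]
      have h2 : g ^ 2 / (D + g ^ 2) ≤ 1 := by
        rw [div_le_one hE]; linarith
      have h3 : 0 ≤ k₂ ^ 2 / (D + g ^ 2) := by positivity
      have h4 : 0 ≤ k₁ ^ 2 / D := by positivity
      nlinarith
    · have e3 : D * (c - (g * k₂ / (D + g ^ 2)) ^ 2) -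
          (k₁ ^ 2 + (k₂ - g * (g * k₂ / (D + g ^ 2))) ^ 2) = D * (c - q) := by
        rw [hq]; field_simp; ring
      nlinarith

/-- Writing modulus and phase as squares makes half phases available, so that one rotation of `u`
can align two phases at once. -/
theorem exists_polar_sq (z : ℂ) :
    ∃ (d : ℝ) (f : ℂ), 0 ≤ d ∧ Complex.normSq f = 1 ∧ z = d ^ 2 * f ^ 2 := by
  refine ⟨√‖z‖, Complex.exp ((z.arg / 2 : ℝ) * Complex.I), Real.sqrt_nonneg _, ?_, ?_⟩
  · rw [Complex.normSq_eq_norm_sq, Complex.norm_exp_ofReal_mul_I, one_pow]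
  · rw [← Complex.exp_nat_mul, ← Complex.ofReal_pow, Real.sq_sqrt (norm_nonneg z)]
    conv_lhs => rw [← Complex.norm_mul_exp_arg_mul_I z]
    congr 2
    push_cast
    ring

/-- A Cholesky factorisation, valid also when the leading entry vanishes. -/
theorem exists_kraus_of_mul_le {a c : ℝ} {b : ℂ} (ha : 0 ≤ a) (hc : 0 ≤ c)
    (h : Complex.normSq b ≤ a * c) :
    ∃ r₀ r₁ q : ℂ, star r₀ * r₀ = a ∧ star r₀ * r₁ = b ∧
      star r₁ * r₁ + star q * q = c := by
  rcases ha.eq_or_lt with rfl | ha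
  · have hb : b = 0 := by
      rw [zero_mul] at h
      exact Complex.normSq_eq_zero.1 (le_antisymm h (Complex.normSq_nonneg b))
    refine ⟨0, 0, (√c : ℝ), by simp, by simp [hb], ?_⟩
    rw [Complex.star_def, Complex.conj_ofReal, ← Complex.ofReal_mul, Real.mul_self_sqrt hc]
    simp
  · have hs : 0 < √a := Real.sqrt_pos.2 ha
    have hs' : ((√a : ℝ) : ℂ) ≠ 0 := by exact_mod_cast hs.ne'
    have hs2 : √a * √a = a := Real.mul_self_sqrt ha.le
    have hq : 0 ≤ c - Complex.normSq b / a := by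
      rw [sub_nonneg, div_le_iff₀ ha]
      linarith
    refine ⟨(√a : ℝ), b / (√a : ℝ), (√(c - Complex.normSq b / a) : ℝ), ?_, ?_, ?_⟩
    · rw [Complex.star_def, Complex.conj_ofReal, ← Complex.ofReal_mul, hs2]
    · rw [Complex.star_def, Complex.conj_ofReal]
      field_simp
    · have h1 : star (b / (√a : ℝ)) * (b / (√a : ℝ)) = ((Complex.normSq b / a : ℝ) : ℂ) := by
        rw [Complex.star_def, ← Complex.normSq_eq_conj_mul_self, Complex.normSq_div,
          Complex.normSq_ofReal, hs2]
      rw [h1, Complex.star_def, Complex.conj_ofReal, ← Complex.ofReal_mul,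
        Real.mul_self_sqrt hq, ← Complex.ofReal_add]
      congr 1
      ring

theorem sq_le_of_forall_quadratic_nonneg {A B C : ℝ}
    (h : ∀ r : ℝ, 0 ≤ A + 2 * r * B + r ^ 2 * C) : 0 ≤ A ∧ 0 ≤ C ∧ B ^ 2 ≤ C * A := by
  have hA : 0 ≤ A := by simpa using h 0
  have hd : discrim C (2 * B) A ≤ 0 := discrim_le_zero fun r => by
    have := h r
    nlinarith
  have hB : B ^ 2 ≤ C * A := by
    unfold discrim at hd
    nlinarith
  refine ⟨hA, ?_, hB⟩
  by_contra hC
  push Not at hC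
  have h2 := h ((A + 1) / (-C))
  have h3 := h (-((A + 1) / (-C)))
  have e : ((A + 1) / (-C)) ^ 2 * C = - ((A + 1) ^ 2 / (-C)) := by
    have : -C ≠ 0 := by linarith
    field_simp
  have hAC : A * C = 0 := by nlinarith
  have hA0 : A = 0 := by
    rcases mul_eq_zero.1 hAC with h | h
    · exact h
    · exact absurd h hC.ne
  have : 0 < (A + 1) ^ 2 / (-C) := by
    have : 0 < -C := by linarith
    positivity
  nlinarith

/-- Rank-one decomposition of a positive map of `2 × 2` matrices with a product zero,
in coordinates. -/
theorem exists_kraus_of_forall_normSq_le {a c : ℝ} {b β δ ε : ℂ}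
    (h : ∀ (u : ℂ) (r : ℝ), Complex.normSq u = 1 →
      Complex.normSq (u * β + star u * star δ + r * ε) ≤ a + 2 * r * (u * b).re + r ^ 2 * c) :
    ∃ (s t : ℝ) (v₀ v₁ u₀ u₁ r₀ r₁ q : ℂ), s ^ 2 + t ^ 2 = 1 ∧
      s * star v₀ = β ∧ t * u₀ = δ ∧ s * star v₁ + t * star u₁ = ε ∧
      star v₀ * v₀ + star u₀ * u₀ + star r₀ * r₀ = a ∧
      star v₀ * v₁ + u₀ * star u₁ + star r₀ * r₁ = b ∧
      star v₁ * v₁ + star u₁ * u₁ + (star r₁ * r₁ + star q * q) = c := by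
  obtain ⟨d, f, hd, hf, rfl⟩ := exists_polar_sq δ
  obtain ⟨e, f', he, hf', rfl⟩ := exists_polar_sq β
  have hfs : star f * f = 1 := by
    rw [Complex.star_def, ← Complex.normSq_eq_conj_mul_self, hf, Complex.ofReal_one]
  have hfs' : star f' * f' = 1 := by
    rw [Complex.star_def, ← Complex.normSq_eq_conj_mul_self, hf', Complex.ofReal_one]
  have sr : ∀ x : ℝ, star (x : ℂ) = x := fun x => Complex.conj_ofReal x
  -- The first two terms of `b` cancel the cross term with `ε` in the squared modulus; `k` is what
  -- remains of the coefficient linear in `r`.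
  obtain ⟨k, hk⟩ : ∃ k : ℂ, b = star ε * (e ^ 2 * f' ^ 2) + ε * (d ^ 2 * f ^ 2) + f * f' * k := by
    refine ⟨star f * star f' * (b - (star ε * (e ^ 2 * f' ^ 2) + ε * (d ^ 2 * f ^ 2))), ?_⟩
    linear_combination (-(b - (star ε * (e ^ 2 * f' ^ 2) + ε * (d ^ 2 * f ^ 2)))) *
      (hfs * (star f' * f') + hfs')
  have hreal : ∀ C S : ℝ, C ^ 2 + S ^ 2 = 1 → ∀ r : ℝ,
      0 ≤ ((a - (d ^ 2 + e ^ 2) ^ 2) * C ^ 2 +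
        (a - (d ^ 2 + e ^ 2) ^ 2 + (2 * d * e) ^ 2) * S ^ 2) +
        2 * r * (C * k.re - S * k.im) + r ^ 2 * (c - Complex.normSq ε) := by
    intro C S hCS r
    have hCS' : Complex.normSq (⟨C, S⟩ : ℂ) = 1 := by
      rw [Complex.normSq_mk]; linarith
    -- This rotation gives both `u β` and `star u * star δ` the common phase `star f * f'`, so their
    -- sum has squared modulus `(e² + d²)² C² + (e² - d²)² S²`.
    have h1 := h (star f * star f' * ⟨C, S⟩) r (by
      rw [Complex.normSq_mul, Complex.normSq_mul, hCS', Complex.star_def,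
        Complex.normSq_conj, Complex.normSq_conj, hf, hf']; norm_num)
    obtain ⟨g, hg⟩ : ∃ g : ℂ, g = star f * f' := ⟨_, rfl⟩
    have hgn : Complex.normSq g = 1 := by
      rw [hg, Complex.normSq_mul, Complex.star_def, Complex.normSq_conj, hf, hf', one_mul]
    have hz : star (⟨C, S⟩ : ℂ) = ⟨C, -S⟩ := rfl
    have e₁ : star f * star f' * ⟨C, S⟩ * (e ^ 2 * f' ^ 2) +
        star (star f * star f' * ⟨C, S⟩) * star (d ^ 2 * f ^ 2) + r * ε =
        g * (e ^ 2 * ⟨C, S⟩ + d ^ 2 * ⟨C, -S⟩) + r * ε := by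
      simp only [hg, star_mul', star_star, star_pow, hz, sr]
      linear_combination (e ^ 2 * star f * f' * ⟨C, S⟩) * hfs' +
        (d ^ 2 * star f * f' * ⟨C, -S⟩) * hfs
    have e₂ : star f * star f' * ⟨C, S⟩ * b =
        star ε * e ^ 2 * g * ⟨C, S⟩ + ε * d ^ 2 * star g * ⟨C, S⟩ + ⟨C, S⟩ * k := by
      simp only [hk, hg, star_mul', star_star]
      linear_combination (star ε * e ^ 2 * star f * f' * ⟨C, S⟩ +
        ⟨C, S⟩ * k * (star f * f)) * hfs' +
        (ε * d ^ 2 * star f' * f * ⟨C, S⟩ + ⟨C, S⟩ * k) * hfs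
    rw [e₁, e₂] at h1
    clear e₁ e₂ hk hg h
    obtain ⟨x, y⟩ := g
    obtain ⟨k₁, k₂⟩ := k
    obtain ⟨ε₁, ε₂⟩ := ε
    simp only [Complex.normSq_apply, Complex.star_def, Complex.add_re, Complex.add_im,
      Complex.mul_re, Complex.mul_im, ← Complex.ofReal_pow, Complex.ofReal_re, Complex.ofReal_im,
      Complex.conj_re, Complex.conj_im] at h1 hgn ⊢
    linear_combination h1 - a * hCS -
      ((e ^ 2 + d ^ 2) ^ 2 * C ^ 2 + (e ^ 2 - d ^ 2) ^ 2 * S ^ 2) * hgn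
  have hq := fun C S hCS => sq_le_of_forall_quadratic_nonneg (hreal C S hCS)
  have hD := (hq 1 0 (by norm_num)).1
  have hc' := (hq 1 0 (by norm_num)).2.1
  have hD' : 0 ≤ a - (d ^ 2 + e ^ 2) ^ 2 := by linarith
  obtain ⟨w, hw, hkw⟩ := exists_shift_of_quadratic_le hD' hc'
    (fun C S hCS => (hq C S hCS).2.2)
  have hN : Complex.normSq (f * f' * (k - 2 * d * e * w * Complex.I)) ≤
      (a - (d ^ 2 + e ^ 2) ^ 2) * (c - Complex.normSq ε - w ^ 2) := by
    rw [Complex.normSq_mul, Complex.normSq_mul, hf, hf']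
    refine le_trans (le_of_eq ?_) hkw
    simp [Complex.normSq_apply]
    ring
  obtain ⟨r₀, r₁, q, hr₀, hr₁, hqr⟩ := exists_kraus_of_mul_le hD' (by linarith) hN
  -- The unit vector `(s, t)` is parallel to `(e, d)`; this makes `|v₀|² + |u₀|²` equal to `(d² +
  -- e²)²`.
  obtain ⟨s, t, n, hst, hsn, htn, hn⟩ : ∃ s t n : ℝ, s ^ 2 + t ^ 2 = 1 ∧ s * n = e ∧ t * n = d ∧
      n ^ 2 = d ^ 2 + e ^ 2 := by
    by_cases h0 : d ^ 2 + e ^ 2 = 0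
    · have hd0 : d = 0 := by nlinarith [sq_nonneg e, sq_nonneg d]
      have he0 : e = 0 := by nlinarith [sq_nonneg e, sq_nonneg d]
      exact ⟨1, 0, 0, by norm_num, by simp [he0], by simp [hd0], by simp [hd0, he0]⟩
    · have hp : 0 < d ^ 2 + e ^ 2 := lt_of_le_of_ne (by positivity) (Ne.symm h0)
      have hn2 : √(d ^ 2 + e ^ 2) ^ 2 = d ^ 2 + e ^ 2 := Real.sq_sqrt hp.le
      have hn0 : √(d ^ 2 + e ^ 2) ≠ 0 := (Real.sqrt_pos.2 hp).ne'
      refine ⟨e / √(d ^ 2 + e ^ 2), d / √(d ^ 2 + e ^ 2), √(d ^ 2 + e ^ 2), ?_, ?_, ?_, hn2⟩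
      · rw [div_pow, div_pow, hn2]
        field_simp
        ring
      · field_simp
      · field_simp
  have hst' : (s : ℂ) ^ 2 + (t : ℂ) ^ 2 = 1 := by exact_mod_cast hst
  have hsn' : (s : ℂ) * n = e := by exact_mod_cast hsn
  have htn' : (t : ℂ) * n = d := by exact_mod_cast htn
  have hn' : (n : ℂ) ^ 2 = (d : ℂ) ^ 2 + (e : ℂ) ^ 2 := by exact_mod_cast hn
  have hεε : star ε * ε = (Complex.normSq ε : ℂ) := by
    rw [Complex.star_def, Complex.normSq_eq_conj_mul_self]
  have sI : star Complex.I = -Complex.I := Complex.conj_I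
  -- The constraint on `ε` fixes `(v₁, u₁)` along `(s, t)`; up to phases, `w` is its component along
  -- `(t, -s)`. It moves `2 d e w i` into the cross term `b` and costs `w²` in `c`.
  refine ⟨s, t, n * e * star f' ^ 2, s * star ε + t * (w * Complex.I * star f' * f),
    n * d * f ^ 2, t * star ε - s * (w * Complex.I * star f' * f), r₀, r₁, q, hst, ?_, ?_, ?_,
    ?_, ?_, ?_⟩
  · simp only [star_mul', star_pow, star_star, sr]
    linear_combination (e * f' ^ 2) * hsn'
  · linear_combination (d * f ^ 2) * htn'
  · simp only [star_mul', star_add, star_sub, star_star, sr, sI]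
    linear_combination ε * hst'
  · rw [hr₀]
    simp only [star_mul', star_pow, star_star, sr]
    push_cast
    linear_combination (n ^ 2 * e ^ 2 * (star f' * f' + 1) : ℂ) * hfs' +
      (n ^ 2 * d ^ 2 * (star f * f + 1) : ℂ) * hfs + (d ^ 2 + e ^ 2 : ℂ) * hn'
  · rw [hr₁, hk]
    simp only [star_mul', star_sub, star_pow, star_star, sr, sI]
    linear_combination (e * f' ^ 2 * star ε + d * w * Complex.I * f * f') * hsn' +
      (n * e * t * w * Complex.I * f' * f) * hfs' +
      (d * f ^ 2 * ε + e * w * Complex.I * f * f') * htn' +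
      (n * d * s * w * Complex.I * f * f') * hfs
  · rw [hqr]
    simp only [star_mul', star_add, star_sub, star_star, sr, sI]
    push_cast
    rw [← hεε]
    linear_combination (star ε * ε - Complex.I ^ 2 * w ^ 2 * (star f' * f') * (star f * f)) *
      hst' - (w ^ 2 * (star f' * f') * (star f * f)) * Complex.I_sq +
      (w ^ 2 * (star f * f)) * hfs' + w ^ 2 * hfs

/-! ### Positive maps of `2 × 2` matrices are decomposable -/

theorem _root_.Matrix.PosSemidef.fin_two {P : Op (Fin 2)} (hP : P.PosSemidef) :
    P 1 0 = star (P 0 1) ∧ P 0 0 = ((P 0 0).re : ℂ) ∧ P 1 1 = ((P 1 1).re : ℂ) ∧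
      0 ≤ (P 0 0).re ∧ 0 ≤ (P 1 1).re ∧
      Complex.normSq (P 0 1) ≤ (P 0 0).re * (P 1 1).re := by
  have h0 := Complex.nonneg_iff.1 (hP.diag_nonneg (i := 0))
  have h1 := Complex.nonneg_iff.1 (hP.diag_nonneg (i := 1))
  have h10 : P 1 0 = star (P 0 1) := (hP.isHermitian.apply 1 0).symm
  have e0 : P 0 0 = ((P 0 0).re : ℂ) := Complex.ext rfl (by simpa using h0.2.symm)
  have e1 : P 1 1 = ((P 1 1).re : ℂ) := Complex.ext rfl (by simpa using h1.2.symm)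
  refine ⟨h10, e0, e1, h0.1, h1.1, ?_⟩
  have hd := hP.det_nonneg
  rw [Matrix.det_fin_two, h10, e0, e1, Complex.star_def, Complex.mul_conj,
    ← Complex.ofReal_mul, ← Complex.ofReal_sub, Complex.zero_le_real] at hd
  linarith

theorem map_vecMulVec_fin_two (Θ : Op (Fin 2) →ₗ[ℂ] Op (Fin 2)) (x y : Fin 2 → ℂ) :
    Θ (Matrix.vecMulVec x y) = (x 0 * y 0) • Θ (Matrix.single 0 0 1) +
      (x 0 * y 1) • Θ (Matrix.single 0 1 1) + (x 1 * y 0) • Θ (Matrix.single 1 0 1) +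
      (x 1 * y 1) • Θ (Matrix.single 1 1 1) := by
  simp only [← map_smul, ← map_add]
  congr 1
  ext i j
  fin_cases i <;> fin_cases j <;> simp [Matrix.vecMulVec_apply]

theorem linearMap_ext_fin_two {f g : Op (Fin 2) →ₗ[ℂ] Op (Fin 2)}
    (h : ∀ i j, f (Matrix.single i j 1) = g (Matrix.single i j 1)) : f = g :=
  Matrix.ext_linearMap ℂ fun i j => LinearMap.ext_ring (h i j)

theorem conjMap_single_apply (V : Op (Fin 2)) (i j k l : Fin 2) :
    conjMap V (Matrix.single i j 1) k l = V k i * star (V l j) := by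
  rw [conjMap_apply, Matrix.single_eq_single_vecMulVec_single]
  simp [Matrix.mul_vecMulVec, Matrix.vecMulVec_mul, Matrix.vecMulVec_apply]

theorem conjMap_transposeMap_single_apply (V : Op (Fin 2)) (i j k l : Fin 2) :
    (conjMap V ∘ₗ transposeMap (Fin 2)) (Matrix.single i j 1) k l = V k j * star (V l i) := by
  rw [LinearMap.comp_apply, transposeMap_apply, Matrix.transpose_single, conjMap_single_apply]

/-- A positive map of `2 × 2` matrices with a product zero at the first basis vectors
is decomposable. -/
theorem mem_decomposableMaps_of_zero {Θ : Op (Fin 2) →ₗ[ℂ] Op (Fin 2)}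
    (hΘ : ∀ x : Fin 2 → ℂ, (Θ (Matrix.vecMulVec x (star x))).PosSemidef)
    (h0 : Θ (Matrix.single 0 0 1) 0 0 = 0) : Θ ∈ decomposableMaps (Fin 2) (Fin 2) := by
  obtain ⟨A, hA⟩ : ∃ A, A = Θ (Matrix.single 0 0 1) := ⟨_, rfl⟩
  obtain ⟨B, hB⟩ : ∃ B, B = Θ (Matrix.single 1 0 1) := ⟨_, rfl⟩
  obtain ⟨B', hB'⟩ : ∃ B', B' = Θ (Matrix.single 0 1 1) := ⟨_, rfl⟩
  obtain ⟨C, hC⟩ : ∃ C, C = Θ (Matrix.single 1 1 1) := ⟨_, rfl⟩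
  have hM : ∀ z : ℂ, (A + star z • B' + z • B + (z * star z) • C).PosSemidef := by
    intro z
    have h := hΘ ![1, z]
    rw [map_vecMulVec_fin_two, ← hA, ← hB, ← hB', ← hC] at h
    simpa using h
  have hApos : A.PosSemidef := by simpa using hM 0
  have hCpos : C.PosSemidef := by
    have h := hΘ ![0, 1]
    rw [map_vecMulVec_fin_two, ← hA, ← hB, ← hB', ← hC] at h
    simpa using h
  -- Positivity on rank-one operators makes the map preserve adjoints, by polarisation at `z = 1`
  -- and `z = i`.
  have hBB : ∀ k l, B' k l = star (B l k) := by
    intro k l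
    have h1 := (hM 1).isHermitian.apply k l
    have h2 := (hM Complex.I).isHermitian.apply k l
    have h3 := hApos.isHermitian.apply k l
    have h4 := hCpos.isHermitian.apply k l
    simp only [Matrix.add_apply, Matrix.smul_apply, smul_eq_mul, star_add, star_mul', star_one,
      Complex.star_def, Complex.conj_I, map_neg, one_mul] at h1 h2 h3 h4 ⊢
    linear_combination (-1 / 2) * (Complex.I * (h2 - h3 + Complex.I ^ 2 * h4) + (h1 - h3 - h4) -
      ((starRingEnd ℂ) (B' l k) - (starRingEnd ℂ) (B l k) + B' k l - B k l) * Complex.I_sq)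
  obtain ⟨a10, a00, a11, -, ha, aa⟩ := hApos.fin_two
  obtain ⟨c10, c00, c11, hγ, hc, -⟩ := hCpos.fin_two
  have hA00 : A 0 0 = 0 := by rw [hA, h0]
  have hA01 : A 0 1 = 0 := by
    rw [hA00, Complex.zero_re, zero_mul] at aa
    exact Complex.normSq_eq_zero.1 (le_antisymm aa (Complex.normSq_nonneg _))
  obtain ⟨γ, hγe⟩ : ∃ γ, γ = (C 0 0).re := ⟨_, rfl⟩
  obtain ⟨a, hae⟩ : ∃ a, a = (A 1 1).re := ⟨_, rfl⟩
  obtain ⟨c, hce⟩ : ∃ c, c = (C 1 1).re := ⟨_, rfl⟩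
  rw [← hγe] at c00 hγ
  rw [← hae] at a11 ha
  rw [← hce] at c11 hc
  have hz : ∀ (u : ℂ) (r : ℝ), Complex.normSq u = 1 →
      (r * u) * star (r * u) = ((r ^ 2 : ℝ) : ℂ) := by
    intro u r hu
    rw [Complex.star_def, Complex.mul_conj, Complex.normSq_mul, hu, Complex.normSq_ofReal]
    congr 1
    ring
  have hM' : ∀ (u : ℂ) (r : ℝ), Complex.normSq u = 1 →
      (A + star (r * u) • B' + (r * u) • B + ((r ^ 2 : ℝ) : ℂ) • C).PosSemidef := by
    intro u r hu
    rw [← hz u r hu]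
    exact hM _
  have e00 : ∀ (u : ℂ) (r : ℝ), ((A + star (r * u) • B' + (r * u) • B +
      ((r ^ 2 : ℝ) : ℂ) • C) 0 0).re = 0 + 2 * r * (u * B 0 0).re + r ^ 2 * γ := by
    intro u r
    simp [hA00, c00, hBB, -Complex.ofReal_pow]
    ring
  have e11 : ∀ (u : ℂ) (r : ℝ), ((A + star (r * u) • B' + (r * u) • B +
      ((r ^ 2 : ℝ) : ℂ) • C) 1 1).re = a + 2 * r * (u * B 1 1).re + r ^ 2 * c := by
    intro u r
    simp [a11, c11, hBB, -Complex.ofReal_pow]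
    ring
  have e01 : ∀ (u : ℂ) (r : ℝ), (A + star (r * u) • B' + (r * u) • B +
      ((r ^ 2 : ℝ) : ℂ) • C) 0 1 = r * (u * B 0 1 + star u * star (B 1 0) + r * C 0 1) := by
    intro u r
    simp [hA01, hBB]
    ring
  -- The `(0,0)` entry has no constant term in `r`, so nonnegativity for both signs of `r` kills its
  -- linear term.
  have hB00 : B 0 0 = 0 := by
    have h : ∀ u : ℂ, Complex.normSq u = 1 → (u * B 0 0).re = 0 := by
      intro u hu
      have := sq_le_of_forall_quadratic_nonneg fun r => by
        rw [← e00]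
        exact (hM' u r hu).fin_two.2.2.2.1
      nlinarith [this.2.2, sq_nonneg (u * B 0 0).re]
    have h1 := h 1 (by simp)
    have h2 := h Complex.I (by simp)
    exact Complex.ext (by simpa using h1) (by simpa using h2)
  have main : ∀ (u : ℂ) (r : ℝ), Complex.normSq u = 1 →
      Complex.normSq (u * B 0 1 + star u * star (B 1 0) + r * C 0 1) ≤
        γ * (a + 2 * r * (u * B 1 1).re + r ^ 2 * c) := by
    intro u r hu
    have hcl : IsClosed {r : ℝ | Complex.normSq (u * B 0 1 + star u * star (B 1 0) + r * C 0 1) ≤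
        γ * (a + 2 * r * (u * B 1 1).re + r ^ 2 * c)} :=
      isClosed_le (Complex.continuous_normSq.comp (by fun_prop)) (by fun_prop)
    -- The determinant inequality carries a factor `r²`; it is cancelled for `r ≠ 0` and the result
    -- extends to `r = 0` by continuity.
    refine hcl.closure_subset_iff.2 ?_ ((dense_compl_singleton (0 : ℝ)) r)
    intro r hr
    have hr : r ≠ 0 := hr
    have h := (hM' u r hu).fin_two.2.2.2.2.2
    rw [e00, e11, e01, hB00, Complex.normSq_mul, Complex.normSq_ofReal, mul_zero,
      Complex.zero_re] at h
    refine le_of_mul_le_mul_left ?_ (show 0 < r ^ 2 by positivity)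
    linarith
  obtain ⟨β, δ, ε, hβ, hδ, hε, hh⟩ : ∃ β δ ε : ℂ, B 0 1 = (√γ : ℝ) * β ∧ B 1 0 = (√γ : ℝ) * δ ∧
      C 0 1 = (√γ : ℝ) * ε ∧ ∀ (u : ℂ) (r : ℝ), Complex.normSq u = 1 →
      Complex.normSq (u * β + star u * star δ + r * ε) ≤
        a + 2 * r * (u * B 1 1).re + r ^ 2 * c := by
    -- If `γ = 0`, `main` forces the three off-diagonal entries to vanish, and the claim reduces to
    -- nonnegativity of the `(1,1)` entry.
    rcases hγ.eq_or_lt with hγ0 | hγ0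
    · rw [← hγ0] at main ⊢
      have hz0 : ∀ (u : ℂ) (r : ℝ), Complex.normSq u = 1 →
          u * B 0 1 + star u * star (B 1 0) + r * C 0 1 = 0 := fun u r hu =>
        Complex.normSq_eq_zero.1 (le_antisymm (by simpa using main u r hu) (Complex.normSq_nonneg _))
      have z1 := hz0 1 0 (by simp)
      have z2 := hz0 Complex.I 0 (by simp)
      have z3 := hz0 1 1 (by simp)
      simp at z1 z2 z3
      have z4 : B 0 1 = (starRingEnd ℂ) (B 1 0) := by
        have := mul_left_cancel₀ Complex.I_ne_zero (show Complex.I * B 0 1 =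
          Complex.I * (starRingEnd ℂ) (B 1 0) by linear_combination z2)
        exact this
      have z5 : B 0 1 = 0 := by linear_combination (z1 + z4) / 2
      have z6 : B 1 0 = 0 := by rw [z5] at z4; simpa using z4.symm
      have z7 : C 0 1 = 0 := by simpa [z5, z6] using z3
      refine ⟨0, 0, 0, by simp [z5], by simp [z6], by simp [z7], ?_⟩
      intro u r hu
      rw [← e11]
      simpa using (hM' u r hu).fin_two.2.2.2.2.1
    · have hs : 0 < √γ := Real.sqrt_pos.2 hγ0
      have hs' : ((√γ : ℝ) : ℂ) ≠ 0 := by exact_mod_cast hs.ne'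
      refine ⟨B 0 1 / (√γ : ℝ), B 1 0 / (√γ : ℝ), C 0 1 / (√γ : ℝ), by field_simp, by field_simp,
        by field_simp, ?_⟩
      intro u r hu
      have h := main u r hu
      have e : u * (B 0 1 / (√γ : ℝ)) + star u * star (B 1 0 / (√γ : ℝ)) +
          r * (C 0 1 / (√γ : ℝ)) =
          (u * B 0 1 + star u * star (B 1 0) + r * C 0 1) / (√γ : ℝ) := by
        simp only [Complex.star_def, map_div₀, Complex.conj_ofReal]
        field_simp
      rw [e, Complex.normSq_div, Complex.normSq_ofReal, Real.mul_self_sqrt hγ, div_le_iff₀ hγ0]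
      linarith
  obtain ⟨s, t, v₀, v₁, u₀, u₁, r₀, r₁, q, hst, hsv, htu, hsvt, h₁, h₂, h₃⟩ :=
    exists_kraus_of_forall_normSq_le hh
  have hΘe : Θ = conjMap !![0, (√γ * s : ℝ); v₀, v₁] +
      conjMap !![0, (√γ * t : ℝ); u₀, u₁] ∘ₗ transposeMap (Fin 2) +
      conjMap !![0, 0; r₀, r₁] + conjMap !![0, 0; 0, q] := by
    have hγ2 : ((√γ : ℝ) : ℂ) ^ 2 = γ := by exact_mod_cast Real.sq_sqrt hγ
    have hst' : (s : ℂ) ^ 2 + (t : ℂ) ^ 2 = 1 := by exact_mod_cast hst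
    have hsv' := congrArg star hsv
    have htu' := congrArg star htu
    have hsvt' := congrArg star hsvt
    have h₂' := congrArg star h₂
    simp only [star_mul', star_add, Complex.star_def, Complex.conj_ofReal, Complex.conj_conj]
      at hsv hsvt h₁ h₂ h₃ hsv' htu' hsvt' h₂'
    refine linearMap_ext_fin_two fun i j => ?_
    ext k l
    simp only [LinearMap.add_apply, Matrix.add_apply, conjMap_single_apply,
      conjMap_transposeMap_single_apply]
    fin_cases i <;> fin_cases j <;> fin_cases k <;> fin_cases l <;>
      simp [← hA, ← hB, ← hB', ← hC, hBB, hA00, hA01, a10, a11, hB00, hβ, hδ, hε, c00, c10, c11]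
    · linear_combination -h₁
    · linear_combination -((√γ : ℝ) : ℂ) * htu'
    · linear_combination -((√γ : ℝ) : ℂ) * hsv'
    · linear_combination -h₂'
    · linear_combination -((√γ : ℝ) : ℂ) * hsv
    · linear_combination -((√γ : ℝ) : ℂ) * htu
    · linear_combination -h₂
    · linear_combination -hγ2 - ((√γ : ℝ) : ℂ) ^ 2 * hst'
    · linear_combination -((√γ : ℝ) : ℂ) * hsvt
    · linear_combination -((√γ : ℝ) : ℂ) * hsvt'
    · linear_combination -h₃
  rw [hΘe]
  exact add_mem (add_mem (add_mem (conjMap_mem_decomposableMaps _)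
    (conjMap_comp_transposeMap_mem_decomposableMaps _)) (conjMap_mem_decomposableMaps _))
    (conjMap_mem_decomposableMaps _)

/-! ### Reduction of a positive map to one with a product zero. -/

/-- The map `X ↦ tr[X] 1`. -/
def traceOne : Op (Fin 2) →ₗ[ℂ] Op (Fin 2) where
  toFun X := X.trace • 1
  map_add' X Y := by rw [Matrix.trace_add, add_smul]
  map_smul' c X := by rw [Matrix.trace_smul, smul_eq_mul, mul_smul, RingHom.id_apply]

theorem traceOne_apply (X : Op (Fin 2)) : traceOne X = X.trace • 1 := rfl

theorem traceOne_mem_decomposableMaps : traceOne ∈ decomposableMaps (Fin 2) (Fin 2) := by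
  have h : traceOne = ∑ i : Fin 2, ∑ j : Fin 2, conjMap (Matrix.single i j 1) := by
    ext1 X
    ext k l
    fin_cases k <;> fin_cases l <;>
      simp [traceOne_apply, conjMap_apply, Matrix.trace, Fin.sum_univ_two]
  rw [h]
  exact sum_mem fun i _ => sum_mem fun j _ => conjMap_mem_decomposableMaps _

/-- A unitary with prescribed first column. -/
theorem exists_unitary_col_zero {x : Fin 2 → ℂ}
    (hx : Complex.normSq (x 0) + Complex.normSq (x 1) = 1) :
    ∃ U : Op (Fin 2), U * U.conjTranspose = 1 ∧ U.mulVec (Pi.single 0 1) = x := by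
  have h : x 0 * star (x 0) + x 1 * star (x 1) = 1 := by
    rw [Complex.star_def, Complex.mul_conj, Complex.mul_conj]
    exact_mod_cast hx
  rw [Complex.star_def] at h
  refine ⟨!![x 0, -star (x 1); x 1, star (x 0)], ?_, ?_⟩
  · ext i j
    fin_cases i <;> fin_cases j <;>
      simp [Matrix.mul_apply, Fin.sum_univ_two, Matrix.conjTranspose_apply]
    · linear_combination h
    · ring
    · ring
    · linear_combination h
  · ext i
    fin_cases i <;> simp

theorem conjMap_vecMulVec_star {m p : Type} [Fintype m] (A : Matrix p m ℂ) (x : m → ℂ) :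
    conjMap A (Matrix.vecMulVec x (star x)) =
      Matrix.vecMulVec (A.mulVec x) (star (A.mulVec x)) := by
  rw [conjMap_apply, Matrix.mul_vecMulVec, Matrix.vecMulVec_mul, Matrix.star_mulVec]

theorem isCompact_unit_vectors :
    IsCompact {x : Fin 2 → ℂ | Complex.normSq (x 0) + Complex.normSq (x 1) = 1} := by
  refine Metric.isCompact_of_isClosed_isBounded ?_ ?_
  · exact isClosed_eq ((Complex.continuous_normSq.comp (continuous_apply 0)).add
      (Complex.continuous_normSq.comp (continuous_apply 1))) continuous_const
  · refine (Metric.isBounded_closedBall (x := (0 : Fin 2 → ℂ)) (r := 1)).subset ?_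
    intro x hx
    rw [mem_closedBall_zero_iff, pi_norm_le_iff_of_nonneg zero_le_one]
    have hx : Complex.normSq (x 0) + Complex.normSq (x 1) = 1 := hx
    have h0 := Complex.normSq_nonneg (x 0)
    have h1 := Complex.normSq_nonneg (x 1)
    intro i
    refine (sq_le_one_iff₀ (norm_nonneg _)).1 ?_
    rw [← Complex.normSq_eq_norm_sq]
    fin_cases i
    · exact by simpa using (by linarith : Complex.normSq (x 0) ≤ 1)
    · exact by simpa using (by linarith : Complex.normSq (x 1) ≤ 1)

/-- The real quadratic form of `Θ (x xᴴ)`. -/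
def biquadForm (Θ : Op (Fin 2) →ₗ[ℂ] Op (Fin 2)) (x y : Fin 2 → ℂ) : ℝ :=
  (star y ⬝ᵥ (Θ (Matrix.vecMulVec x (star x))).mulVec y).re

theorem biquadForm_smul (Θ : Op (Fin 2) →ₗ[ℂ] Op (Fin 2)) (x y : Fin 2 → ℂ) (r s : ℝ) :
    biquadForm Θ ((r : ℂ) • x) ((s : ℂ) • y) = r ^ 2 * s ^ 2 * biquadForm Θ x y := by
  have h : star ((s : ℂ) • y) ⬝ᵥ (Θ (Matrix.vecMulVec ((r : ℂ) • x)
      (star ((r : ℂ) • x)))).mulVec ((s : ℂ) • y) = ((r ^ 2 * s ^ 2 : ℝ) : ℂ) *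
      (star y ⬝ᵥ (Θ (Matrix.vecMulVec x (star x))).mulVec y) := by
    have hr : star (r : ℂ) = r := Complex.conj_ofReal r
    have hs : star (s : ℂ) = s := Complex.conj_ofReal s
    simp only [star_smul, hr, hs, Matrix.smul_vecMulVec, Matrix.vecMulVec_smul, map_smul,
      Matrix.smul_mulVec, Matrix.mulVec_smul, smul_dotProduct, dotProduct_smul, smul_eq_mul]
    push_cast
    ring
  rw [biquadForm, h, Complex.re_ofReal_mul]
  rfl

theorem continuous_biquadForm (Θ : Op (Fin 2) →ₗ[ℂ] Op (Fin 2)) :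
    Continuous fun p : (Fin 2 → ℂ) × (Fin 2 → ℂ) => biquadForm Θ p.1 p.2 := by
  have hΘ : Continuous Θ := LinearMap.continuous_of_finiteDimensional Θ
  exact Complex.continuous_re.comp (Continuous.dotProduct continuous_snd.star
    (Continuous.matrix_mulVec
      (hΘ.comp (Continuous.matrix_vecMulVec continuous_fst continuous_fst.star)) continuous_snd))

/-- The least value of the form on unit vectors bounds it on all vectors. -/
theorem exists_biquadForm_min (Θ : Op (Fin 2) →ₗ[ℂ] Op (Fin 2)) :
    ∃ x₀ y₀ : Fin 2 → ℂ, Complex.normSq (x₀ 0) + Complex.normSq (x₀ 1) = 1 ∧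
      Complex.normSq (y₀ 0) + Complex.normSq (y₀ 1) = 1 ∧
      ∀ x y : Fin 2 → ℂ, biquadForm Θ x₀ y₀ *
        ((Complex.normSq (x 0) + Complex.normSq (x 1)) *
          (Complex.normSq (y 0) + Complex.normSq (y 1))) ≤ biquadForm Θ x y := by
  have hne : Set.Nonempty {x : Fin 2 → ℂ | Complex.normSq (x 0) + Complex.normSq (x 1) = 1} :=
    ⟨![1, 0], by simp⟩
  obtain ⟨p, hp, hmin⟩ := (isCompact_unit_vectors.prod isCompact_unit_vectors).exists_isMinOn
    (hne.prod hne) (continuous_biquadForm Θ).continuousOn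
  have unit : ∀ x : Fin 2 → ℂ, ∃ (r : ℝ) (x' : Fin 2 → ℂ),
      Complex.normSq (x' 0) + Complex.normSq (x' 1) = 1 ∧ x = (r : ℂ) • x' ∧
      Complex.normSq (x 0) + Complex.normSq (x 1) = r ^ 2 := by
    intro x
    have h0 := Complex.normSq_nonneg (x 0)
    have h1 := Complex.normSq_nonneg (x 1)
    rcases (add_nonneg h0 h1).eq_or_lt with h | h
    · refine ⟨0, ![1, 0], by simp, ?_, by rw [← h]; simp⟩
      ext i
      fin_cases i
      · have : x 0 = 0 := Complex.normSq_eq_zero.1 (by linarith)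
        simpa using this
      · have : x 1 = 0 := Complex.normSq_eq_zero.1 (by linarith)
        simpa using this
    · have hr : (√(Complex.normSq (x 0) + Complex.normSq (x 1))) ^ 2 = _ := Real.sq_sqrt h.le
      have hr0 := Real.sqrt_pos.2 h
      generalize √(Complex.normSq (x 0) + Complex.normSq (x 1)) = r at hr hr0
      have hrc : (r : ℂ) ≠ 0 := by exact_mod_cast hr0.ne'
      refine ⟨r, (r : ℂ)⁻¹ • x, ?_, ?_, hr.symm⟩
      · simp only [Pi.smul_apply, smul_eq_mul, Complex.normSq_mul, Complex.normSq_inv,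
          Complex.normSq_ofReal]
        field_simp
        linarith
      · rw [smul_smul, mul_inv_cancel₀ hrc, one_smul]
  refine ⟨p.1, p.2, hp.1, hp.2, fun x y => ?_⟩
  obtain ⟨r, x', hx', rfl, hr⟩ := unit x
  obtain ⟨s, y', hy', rfl, hs⟩ := unit y
  rw [hr, hs, biquadForm_smul, mul_comm]
  exact mul_le_mul_of_nonneg_left (hmin (Set.mk_mem_prod hx' hy')) (by positivity)

/-- **Størmer's theorem**: positive maps of `2 × 2` matrices are decomposable. -/
theorem IsPositiveMap.mem_decomposableMaps {Θ : Op (Fin 2) →ₗ[ℂ] Op (Fin 2)}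
    (hΘ : IsPositiveMap Θ) : Θ ∈ decomposableMaps (Fin 2) (Fin 2) := by
  have hpos : ∀ x, (Θ (Matrix.vecMulVec x (star x))).PosSemidef := fun x =>
    hΘ _ (Matrix.posSemidef_vecMulVec_self_star x)
  obtain ⟨x₀, y₀, hx₀, hy₀, hmin⟩ := exists_biquadForm_min Θ
  obtain ⟨m, hm⟩ : ∃ m, m = biquadForm Θ x₀ y₀ := ⟨_, rfl⟩
  rw [← hm] at hmin
  have hm0 : 0 ≤ m := by
    rw [hm]
    exact (Complex.nonneg_iff.1 ((hpos x₀).dotProduct_mulVec_nonneg y₀)).1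
  -- The form of `traceOne` at `(x, y)` is `‖x‖² ‖y‖²` in Euclidean norms, so subtracting `m` times
  -- it keeps positivity on rank-one operators and creates a zero at the minimiser `(x₀, y₀)`.
  obtain ⟨Φ, hΦ⟩ : ∃ Φ, Φ = Θ - (m : ℂ) • traceOne := ⟨_, rfl⟩
  have hform : ∀ x y : Fin 2 → ℂ,
      star y ⬝ᵥ (Φ (Matrix.vecMulVec x (star x))).mulVec y =
        star y ⬝ᵥ (Θ (Matrix.vecMulVec x (star x))).mulVec y -
        ((m * ((Complex.normSq (x 0) + Complex.normSq (x 1)) *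
          (Complex.normSq (y 0) + Complex.normSq (y 1))) : ℝ) : ℂ) := by
    intro x y
    rw [hΦ]
    simp only [LinearMap.sub_apply, LinearMap.smul_apply, traceOne_apply, Matrix.sub_mulVec,
      Matrix.smul_mulVec, Matrix.one_mulVec, dotProduct_sub, dotProduct_smul, smul_eq_mul,
      Matrix.trace_vecMulVec]
    congr 1
    push_cast
    rw [Complex.normSq_eq_conj_mul_self, Complex.normSq_eq_conj_mul_self,
      Complex.normSq_eq_conj_mul_self, Complex.normSq_eq_conj_mul_self]
    simp only [dotProduct, Fin.sum_univ_two, Pi.star_apply, Complex.star_def]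
    ring
  have hΦpos : ∀ x, (Φ (Matrix.vecMulVec x (star x))).PosSemidef := by
    intro x
    refine Matrix.PosSemidef.of_dotProduct_mulVec_nonneg ?_ fun y => ?_
    · rw [hΦ]
      simp only [LinearMap.sub_apply, LinearMap.smul_apply, traceOne_apply, smul_smul]
      refine (hpos x).isHermitian.sub ?_
      have ht : star (Matrix.vecMulVec x (star x)).trace = (Matrix.vecMulVec x (star x)).trace := by
        rw [← Matrix.trace_conjTranspose,
          (Matrix.posSemidef_vecMulVec_self_star x).isHermitian.eq]
      rw [Matrix.IsHermitian, Matrix.conjTranspose_smul, Matrix.conjTranspose_one, star_mul', ht,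
        Complex.star_def, Complex.conj_ofReal]
    · rw [hform]
      have h := Complex.nonneg_iff.1 ((hpos x).dotProduct_mulVec_nonneg y)
      refine Complex.nonneg_iff.2 ⟨?_, ?_⟩
      · rw [Complex.sub_re, Complex.ofReal_re, sub_nonneg]
        exact hmin x y
      · rw [Complex.sub_im, Complex.ofReal_im, sub_zero]
        exact h.2
  have hΦzero : star y₀ ⬝ᵥ (Φ (Matrix.vecMulVec x₀ (star x₀))).mulVec y₀ = 0 := by
    rw [hform, hx₀, hy₀, hm]
    have h := Complex.nonneg_iff.1 ((hpos x₀).dotProduct_mulVec_nonneg y₀)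
    refine Complex.ext ?_ ?_
    · simp [biquadForm]
    · rw [Complex.sub_im, ← h.2, Complex.ofReal_im, sub_zero, Complex.zero_im]
  obtain ⟨U, hU, hUx⟩ := exists_unitary_col_zero hx₀
  obtain ⟨V, hV, hVy⟩ := exists_unitary_col_zero hy₀
  -- The unitaries move the zero from `(x₀, y₀)` to the first basis vectors.
  have hrot : conjMap V.conjTranspose ∘ₗ Φ ∘ₗ conjMap U ∈ decomposableMaps (Fin 2) (Fin 2) := by
    refine mem_decomposableMaps_of_zero (fun x => ?_) ?_
    · rw [LinearMap.comp_apply, LinearMap.comp_apply, conjMap_vecMulVec_star]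
      exact isPositiveMap_conjMap _ _ (hΦpos _)
    · have hs : (Matrix.single 0 0 1 : Op (Fin 2)) =
          Matrix.vecMulVec (Pi.single 0 1) (star (Pi.single 0 1)) := by
        rw [Matrix.single_eq_single_vecMulVec_single, ← Pi.single_star, star_one]
      rw [LinearMap.comp_apply, LinearMap.comp_apply, hs, conjMap_vecMulVec_star, hUx, conjMap_apply,
        Matrix.conjTranspose_conjTranspose, ← hΦzero, ← hVy]
      generalize Φ (Matrix.vecMulVec x₀ (star x₀)) = Z
      rw [Matrix.star_mulVec, Matrix.mulVec_mulVec, Matrix.dotProduct_mulVec,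
        Matrix.vecMul_vecMul, ← Matrix.mul_assoc, ← Matrix.dotProduct_mulVec]
      simp
  have hback : Φ = conjMap V ∘ₗ (conjMap V.conjTranspose ∘ₗ Φ ∘ₗ conjMap U) ∘ₗ
      conjMap U.conjTranspose := by
    have h : conjMap V ∘ₗ (conjMap V.conjTranspose ∘ₗ Φ ∘ₗ conjMap U) ∘ₗ
        conjMap U.conjTranspose = (conjMap V ∘ₗ conjMap V.conjTranspose) ∘ₗ Φ ∘ₗ
        (conjMap U ∘ₗ conjMap U.conjTranspose) := by
      simp only [LinearMap.comp_assoc]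
    rw [h, conjMap_comp, conjMap_comp, hU, hV, conjMap_one, LinearMap.id_comp, LinearMap.comp_id]
  have hΦmem : Φ ∈ decomposableMaps (Fin 2) (Fin 2) := by
    rw [hback]
    exact conjMap_comp_mem_decomposableMaps _ (comp_conjMap_mem_decomposableMaps hrot _)
  have hΘe : Θ = Φ + (m : ℂ) • traceOne := by rw [hΦ, sub_add_cancel]
  rw [hΘe]
  exact add_mem hΦmem (smul_mem_decomposableMaps traceOne_mem_decomposableMaps hm0)

/-! ### Joint channels from asymmetric cloning -/

/-- The covariant joint map `X ⊗ Y ↦ p X tr[Y] + q tr[X] Y + g (X Y + Y X) + h tr[X] tr[Y] 1`. -/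
def covariantJointMap (p q g h : ℝ) : Op (Fin 2 × Fin 2) →ₗ[ℂ] Op (Fin 2) where
  toFun Z := Matrix.of fun i j => ∑ k, ((p : ℂ) * Z (i, k) (j, k) + q * Z (k, i) (k, j) +
    g * (Z (i, k) (k, j) + Z (k, i) (j, k))) +
    h * (∑ k, ∑ l, Z (k, l) (k, l)) * (1 : Op (Fin 2)) i j
  map_add' X Y := by
    ext i j
    simp only [Matrix.of_apply, Matrix.add_apply, Fin.sum_univ_two]
    ring
  map_smul' c X := by
    ext i j
    simp only [Matrix.of_apply, Matrix.smul_apply, Fin.sum_univ_two, RingHom.id_apply,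
      smul_eq_mul]
    ring

theorem covariantJointMap_kronecker (p q g h : ℝ) (X Y : Op (Fin 2)) :
    covariantJointMap p q g h (X ⊗ₖ Y) = ((p : ℂ) * Y.trace) • X + ((q : ℂ) * X.trace) • Y +
      (g : ℂ) • (X * Y + Y * X) + ((h : ℂ) * (X.trace * Y.trace)) • (1 : Op (Fin 2)) := by
  ext i j
  simp only [covariantJointMap, LinearMap.coe_mk, AddHom.coe_mk, Matrix.of_apply,
    Matrix.kronecker_apply, Matrix.add_apply, Matrix.smul_apply, smul_eq_mul, Matrix.mul_apply,
    Matrix.trace, Matrix.diag_apply, Fin.sum_univ_two]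
  ring

theorem hasMarginals_covariantJointMap {η₁ η₂ p q g h : ℝ} (h₁ : η₁ = 2 * p + 2 * g)
    (h₂ : η₂ = 2 * q + 2 * g) (hu : 2 * p + 2 * q + 2 * g + 4 * h = 1) :
    HasMarginals (covariantJointMap p q g h) (noisyId η₁) (noisyId η₂) := by
  subst h₁ h₂
  have hu' : (h : ℂ) * 2 = (1 - (2 * p + 2 * g)) / 2 - q := by
    have : h * 2 = (1 - (2 * p + 2 * g)) / 2 - q := by linarith
    exact_mod_cast this
  have hu'' : (h : ℂ) * 2 = (1 - (2 * q + 2 * g)) / 2 - p := by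
    have : h * 2 = (1 - (2 * q + 2 * g)) / 2 - p := by linarith
    exact_mod_cast this
  constructor
  · intro X
    rw [covariantJointMap_kronecker]
    ext i j
    simp [noisyId]
    linear_combination X.trace * (1 : Op (Fin 2)) i j * hu'
  · intro Y
    rw [covariantJointMap_kronecker]
    ext i j
    simp [noisyId]
    linear_combination Y.trace * (1 : Op (Fin 2)) i j * hu''

/-- Kraus operators of the cloning channel (Heisenberg picture):
`(x Vₖ + y Wₖ)ᴴ` with `Vₖ ψ = ψ ⊗ eₖ` and `Wₖ ψ = eₖ ⊗ ψ`. -/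
def clonerKraus (x y : ℝ) (k : Fin 2) : Matrix (Fin 2) (Fin 2 × Fin 2) ℂ :=
  Matrix.of fun i r => x * (1 : Op (Fin 2)) i r.1 * (1 : Op (Fin 2)) k r.2 +
    y * (1 : Op (Fin 2)) k r.1 * (1 : Op (Fin 2)) i r.2

/-- The diagonal terms of `x V + y W` give `x² X tr[Y]` and `y² tr[X] Y`, its cross terms `x y (X Y
+ Y X)`; the operators `z W` supply the part of `q` beyond `y²`. -/
theorem covariantJointMap_eq_sum_conjMap (x y z : ℝ) :
    covariantJointMap (x ^ 2) (y ^ 2 + z ^ 2) (x * y) 0 =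
      ∑ k, (conjMap (clonerKraus x y k) + conjMap (clonerKraus 0 z k)) := by
  ext1 Z
  ext i j
  simp only [covariantJointMap, LinearMap.coe_mk, AddHom.coe_mk, Matrix.of_apply,
    Fin.sum_univ_two, LinearMap.add_apply, Matrix.add_apply, conjMap_apply, Matrix.mul_apply,
    Fintype.sum_prod_type, clonerKraus, Matrix.conjTranspose_apply]
  fin_cases i <;> fin_cases j <;> simp [Matrix.one_apply] <;> ring

theorem quantumCompatible_noisyId_of_le {η₁ η₂ : ℝ} (h₂ : η₂ ≤ 1)
    (h : η₁ ^ 2 + η₂ ^ 2 + (1 - η₁ - η₂) ^ 2 ≤ 1) :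
    QuantumCompatible (noisyId η₁) (noisyId η₂) := by
  -- The marginals and unitality determine `p`, `q`, `g` once `h = 0`. Solvability is `g² ≤ p q`,
  -- that is `(η₁ + η₂ - 1)² ≤ (1 - η₁)(1 - η₂)`, a rearrangement of the hypothesis.
  obtain ⟨x, y, z, hx, hyz, hxy⟩ : ∃ x y z : ℝ, x ^ 2 = (1 - η₂) / 2 ∧
      y ^ 2 + z ^ 2 = (1 - η₁) / 2 ∧ x * y = (η₁ + η₂ - 1) / 2 := by
    rcases h₂.eq_or_lt with rfl | h₂
    · have hη : η₁ = 0 := by nlinarith [sq_nonneg η₁]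
      refine ⟨0, 0, √((1 - η₁) / 2), by norm_num, ?_, by rw [hη]; norm_num⟩
      rw [Real.sq_sqrt (by linarith)]
      ring
    · have hp : 0 < (1 - η₂) / 2 := by linarith
      have hs := Real.sqrt_pos.2 hp
      have hs2 := Real.sq_sqrt hp.le
      have hq : 0 ≤ (1 - η₁) / 2 - ((η₁ + η₂ - 1) / 2) ^ 2 / ((1 - η₂) / 2) := by
        rw [sub_nonneg, div_le_iff₀ hp]
        nlinarith
      refine ⟨√((1 - η₂) / 2), (η₁ + η₂ - 1) / 2 / √((1 - η₂) / 2),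
        √((1 - η₁) / 2 - ((η₁ + η₂ - 1) / 2) ^ 2 / ((1 - η₂) / 2)), hs2, ?_, ?_⟩
      · rw [Real.sq_sqrt hq, div_pow, hs2]
        ring
      · field_simp
  have hm : HasMarginals (covariantJointMap (x ^ 2) (y ^ 2 + z ^ 2) (x * y) 0)
      (noisyId η₁) (noisyId η₂) :=
    hasMarginals_covariantJointMap (by linarith) (by linarith) (by linarith)
  refine ⟨_, ⟨?_, ?_⟩, hm⟩
  · rw [← Matrix.one_kronecker_one, hm.1]
    ext i j
    simp [noisyId, Matrix.trace]
    ring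
  · rw [covariantJointMap_eq_sum_conjMap, Fin.sum_univ_two]
    exact ((IsCompletelyPositive.conjMap _).add (IsCompletelyPositive.conjMap _)).add
      ((IsCompletelyPositive.conjMap _).add (IsCompletelyPositive.conjMap _))

/-! ### The witness -/

/-- The witness `c₀ 1 - c₁ Ω₁₃ - c₂ Ω₂₃`, where `Ω` is the unnormalised maximally entangled
projection, with the maps `u`, `v` applied to its first two factors. -/
def pairWitness (c₀ c₁ c₂ : ℝ) (u v : Op (Fin 2) →ₗ[ℂ] Op (Fin 2)) :
    Op ((Fin 2 × Fin 2) × Fin 2) :=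
  (c₀ : ℂ) • ((1 ⊗ₖ 1) ⊗ₖ 1) -
    (c₁ : ℂ) • ∑ i, ∑ j, (u (Matrix.single i j 1) ⊗ₖ 1) ⊗ₖ Matrix.single i j 1 -
    (c₂ : ℂ) • ∑ i, ∑ j, (1 ⊗ₖ v (Matrix.single i j 1)) ⊗ₖ Matrix.single i j 1

theorem tensorMap_pairWitness (c₀ c₁ c₂ : ℝ) {u v : Op (Fin 2) →ₗ[ℂ] Op (Fin 2)}
    (hu : u 1 = 1) (hv : v 1 = 1) :
    tensorMap (tensorMap u v) (LinearMap.id : Op (Fin 2) →ₗ[ℂ] Op (Fin 2))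
      (pairWitness c₀ c₁ c₂ LinearMap.id LinearMap.id) = pairWitness c₀ c₁ c₂ u v := by
  simp only [pairWitness, map_sub, map_smul, map_sum, tensorMap_kronecker, LinearMap.id_apply,
    hu, hv]

theorem isHermitian_pairWitness (c₀ c₁ c₂ : ℝ) {u v : Op (Fin 2) →ₗ[ℂ] Op (Fin 2)}
    (hu : ∀ i j, (u (Matrix.single i j 1)).conjTranspose = u (Matrix.single j i 1))
    (hv : ∀ i j, (v (Matrix.single i j 1)).conjTranspose = v (Matrix.single j i 1)) :
    (pairWitness c₀ c₁ c₂ u v).IsHermitian := by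
  have hs : ∀ c : ℝ, star (c : ℂ) = c := Complex.conj_ofReal
  rw [Matrix.IsHermitian, pairWitness]
  simp only [Matrix.conjTranspose_sub, Matrix.conjTranspose_smul, Matrix.conjTranspose_sum,
    Matrix.conjTranspose_kronecker, Matrix.conjTranspose_one, Matrix.conjTranspose_single,
    star_one, hu, hv, hs]
  congr 1
  · congr 2
    exact Finset.sum_comm
  · congr 1
    exact Finset.sum_comm

/-- The determinant of this form is `(s + c₁ + c₂)(s² - c₁² - c₂² + c₁c₂)`, so the chosen `s` is the
critical one: the form is singular and a sum of two squares. -/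
theorem pairWitness_form_nonneg {c₁ c₂ s : ℝ} (h₁ : 0 ≤ c₁) (h₂ : 0 ≤ c₂) (hs : 0 < s)
    (hs2 : s ^ 2 = c₁ ^ 2 + c₂ ^ 2 - c₁ * c₂) (x y z : ℝ) :
    0 ≤ s * x ^ 2 + (c₂ + s) * y ^ 2 + (c₁ + s) * z ^ 2 - 2 * c₁ * x * y - 2 * c₂ * x * z := by
  have h : (c₂ + s) * (c₁ + s) * (s * x ^ 2 + (c₂ + s) * y ^ 2 + (c₁ + s) * z ^ 2 -
      2 * c₁ * x * y - 2 * c₂ * x * z) =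
      (c₁ + s) * ((c₂ + s) * y - c₁ * x) ^ 2 + (c₂ + s) * ((c₁ + s) * z - c₂ * x) ^ 2 := by
    linear_combination (s + c₁ + c₂) * x ^ 2 * hs2
  have hp : 0 < (c₂ + s) * (c₁ + s) := by positivity
  refine nonneg_of_mul_nonneg_right ?_ hp
  rw [h]
  positivity

/-- The block that appears when exactly one factor is transposed. Completing squares in `x` and `z`
leaves a nonnegative multiple of `y²`. -/
theorem pairWitness_transpose_form_nonneg {c₁ c₂ s : ℝ} (h₁ : 0 ≤ c₁) (h₂ : 0 ≤ c₂) (hs : 0 < s)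
    (hs2 : s ^ 2 = c₁ ^ 2 + c₂ ^ 2 - c₁ * c₂) (x y z : ℝ) :
    0 ≤ s * x ^ 2 + (c₁ + s) * y ^ 2 + (c₁ + c₂ + s) * z ^ 2 - 2 * c₂ * x * y -
      2 * c₁ * y * z := by
  have h : s * (c₁ + c₂ + s) * (s * x ^ 2 + (c₁ + s) * y ^ 2 + (c₁ + c₂ + s) * z ^ 2 -
      2 * c₂ * x * y - 2 * c₁ * y * z) =
      (c₁ + c₂ + s) * (s * x - c₂ * y) ^ 2 + s * ((c₁ + c₂ + s) * z - c₁ * y) ^ 2 +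
      c₁ ^ 2 * (2 * c₁ - c₂ + s) * y ^ 2 := by
    linear_combination (2 * c₁ + c₂ + s) * y ^ 2 * hs2
  have hc : 0 ≤ 2 * c₁ - c₂ + s := by
    by_contra hc
    nlinarith
  have hp : 0 < s * (c₁ + c₂ + s) := by positivity
  refine nonneg_of_mul_nonneg_right ?_ hp
  rw [h]
  positivity

theorem posSemidef_pairWitness {c₁ c₂ s : ℝ} (h₁ : 0 ≤ c₁) (h₂ : 0 ≤ c₂) (hs : 0 < s)
    (hs2 : s ^ 2 = c₁ ^ 2 + c₂ ^ 2 - c₁ * c₂) {u v : Op (Fin 2) →ₗ[ℂ] Op (Fin 2)}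
    (hu : u ∈ ({LinearMap.id, transposeMap (Fin 2)} : Set (Op (Fin 2) →ₗ[ℂ] Op (Fin 2))))
    (hv : v ∈ ({LinearMap.id, transposeMap (Fin 2)} : Set (Op (Fin 2) →ₗ[ℂ] Op (Fin 2)))) :
    (pairWitness (c₁ + c₂ + s) c₁ c₂ u v).PosSemidef := by
  have herm : ∀ w ∈ ({LinearMap.id, transposeMap (Fin 2)} : Set (Op (Fin 2) →ₗ[ℂ] Op (Fin 2))),
      ∀ i j, (w (Matrix.single i j 1)).conjTranspose = w (Matrix.single j i 1) := by
    rintro w (rfl | rfl) i j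
    · simp
    · simp [transposeMap_apply]
  have q := pairWitness_form_nonneg h₁ h₂ hs hs2
  have q₁ := pairWitness_transpose_form_nonneg h₁ h₂ hs hs2
  have q₂ := pairWitness_transpose_form_nonneg h₂ h₁ hs (by linarith)
  refine Matrix.PosSemidef.of_dotProduct_mulVec_nonneg
    (isHermitian_pairWitness _ _ _ (herm u hu) (herm v hv)) fun ψ => ?_
  have sq : ∀ {t : ℝ}, 0 ≤ t → ∀ z : ℂ, 0 ≤ t * (z.re ^ 2 + z.im ^ 2) := fun ht z => by
    positivity
  have sd : ∀ {t : ℝ}, 0 ≤ t → ∀ z w : ℂ,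
      0 ≤ t * ((z.re - w.re) ^ 2 + (z.im - w.im) ^ 2) := fun ht z w => by positivity
  have g₁ := sq (add_nonneg h₁ hs.le)
  have g₂ := sq (add_nonneg h₂ hs.le)
  have g₀ := sq (add_nonneg (add_nonneg h₁ h₂) hs.le)
  rw [Complex.nonneg_iff]
  -- In the first three cases the operator splits into two real `3 × 3` blocks and two diagonal
  -- entries; the forms apply to real and imaginary parts separately.
  rcases hu with rfl | rfl <;> rcases hv with rfl | rfl
  all_goals
    simp [pairWitness, dotProduct, Matrix.mulVec, Fintype.sum_prod_type, Fin.sum_univ_two,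
      transposeMap_apply, Matrix.single_apply, Matrix.one_apply, Matrix.add_apply]
  · refine ⟨?_, by ring⟩
    linarith [q (ψ ((0, 0), 0)).re (ψ ((1, 0), 1)).re (ψ ((0, 1), 1)).re,
      q (ψ ((0, 0), 0)).im (ψ ((1, 0), 1)).im (ψ ((0, 1), 1)).im,
      q (ψ ((1, 1), 1)).re (ψ ((0, 1), 0)).re (ψ ((1, 0), 0)).re,
      q (ψ ((1, 1), 1)).im (ψ ((0, 1), 0)).im (ψ ((1, 0), 0)).im,
      g₀ (ψ ((0, 0), 1)), g₀ (ψ ((1, 1), 0))]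
  · refine ⟨?_, by ring⟩
    linarith [q₂ (ψ ((0, 0), 0)).re (ψ ((1, 0), 1)).re (ψ ((1, 1), 0)).re,
      q₂ (ψ ((0, 0), 0)).im (ψ ((1, 0), 1)).im (ψ ((1, 1), 0)).im,
      q₂ (ψ ((1, 1), 1)).re (ψ ((0, 1), 0)).re (ψ ((0, 0), 1)).re,
      q₂ (ψ ((1, 1), 1)).im (ψ ((0, 1), 0)).im (ψ ((0, 0), 1)).im,
      g₁ (ψ ((1, 0), 0)), g₁ (ψ ((0, 1), 1))]
  · refine ⟨?_, by ring⟩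
    linarith [q₁ (ψ ((0, 0), 0)).re (ψ ((0, 1), 1)).re (ψ ((1, 1), 0)).re,
      q₁ (ψ ((0, 0), 0)).im (ψ ((0, 1), 1)).im (ψ ((1, 1), 0)).im,
      q₁ (ψ ((1, 1), 1)).re (ψ ((1, 0), 0)).re (ψ ((0, 0), 1)).re,
      q₁ (ψ ((1, 1), 1)).im (ψ ((1, 0), 0)).im (ψ ((0, 0), 1)).im,
      g₂ (ψ ((0, 1), 0)), g₂ (ψ ((1, 0), 1))]
  -- With both factors transposed each `Ω` becomes a swap `F`, and the operator is `s + c₁ (1 - F₁₃)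
  -- + c₂ (1 - F₂₃)`.
  · refine ⟨?_, by ring⟩
    linarith [sq hs.le (ψ ((0, 0), 0)), sq hs.le (ψ ((0, 0), 1)), sq hs.le (ψ ((0, 1), 0)),
      sq hs.le (ψ ((0, 1), 1)), sq hs.le (ψ ((1, 0), 0)), sq hs.le (ψ ((1, 0), 1)),
      sq hs.le (ψ ((1, 1), 0)), sq hs.le (ψ ((1, 1), 1)),
      sd h₁ (ψ ((0, 0), 1)) (ψ ((1, 0), 0)), sd h₁ (ψ ((0, 1), 1)) (ψ ((1, 1), 0)),
      sd h₂ (ψ ((0, 0), 1)) (ψ ((0, 1), 0)), sd h₂ (ψ ((1, 0), 1)) (ψ ((1, 1), 0))]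

/-- Joint maps `Ψ ∘ (Θ₁ ⊗ Θ₂)` satisfy the inequality of the witness. -/
theorem marginal_bound {Ψ : Op (Fin 2 × Fin 2) →ₗ[ℂ] Op (Fin 2)}
    {Θ₁ Θ₂ : Op (Fin 2) →ₗ[ℂ] Op (Fin 2)} (hΨ : IsCompletelyPositive Ψ) (hΘ₁ : IsPositiveMap Θ₁)
    (hΘ₂ : IsPositiveMap Θ₂) {η₁ η₂ : ℝ}
    (hm : HasMarginals (Ψ ∘ₗ tensorMap Θ₁ Θ₂) (noisyId η₁) (noisyId η₂))
    {c₁ c₂ s : ℝ} (h₁ : 0 ≤ c₁) (h₂ : 0 ≤ c₂) (hs : 0 < s)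
    (hs2 : s ^ 2 = c₁ ^ 2 + c₂ ^ 2 - c₁ * c₂) :
    c₁ * (3 * η₁ + 1) + c₂ * (3 * η₂ + 1) ≤ 2 * (c₁ + c₂ + s) := by
  have unital : ∀ w ∈ ({LinearMap.id, transposeMap (Fin 2)} :
      Set (Op (Fin 2) →ₗ[ℂ] Op (Fin 2))), w 1 = 1 := by
    rintro w (rfl | rfl)
    · rfl
    · simp [transposeMap_apply]
  have hZ := posSemidef_tensorMap_of_decomposable hΘ₁.mem_decomposableMaps
    hΘ₂.mem_decomposableMaps (r := Fin 2)
    (Z := pairWitness (c₁ + c₂ + s) c₁ c₂ LinearMap.id LinearMap.id) (by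
      intro u hu v hv
      rw [tensorMap_pairWitness _ _ _ (unital u hu) (unital v hv)]
      exact posSemidef_pairWitness h₁ h₂ hs hs2 hu hv)
  have hW := hΨ 2 _ hZ
  rw [← LinearMap.comp_apply, ← tensorMap_comp, LinearMap.id_comp] at hW
  -- The unnormalised maximally entangled vector: it gives `3 ηᵢ + 1` on the image of each `Ω` and
  -- `2` on the identity.
  have h := hW.dotProduct_mulVec_nonneg fun p => if p.1 = p.2 then 1 else 0
  have h1 : (Ψ ∘ₗ tensorMap Θ₁ Θ₂) (1 ⊗ₖ 1) = noisyId η₁ 1 := hm.1 1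
  simp only [pairWitness, map_sub, map_smul, map_sum, tensorMap_kronecker, LinearMap.id_apply,
    h1, hm.1, hm.2] at h
  have h := (Complex.nonneg_iff.1 h).1
  simp [noisyId, dotProduct, Matrix.mulVec, Fintype.sum_prod_type, Fin.sum_univ_two,
    Matrix.one_apply, Matrix.add_apply, Matrix.trace, Matrix.single_apply] at h
  linarith

theorem AlmostQuantumCompatible.le_one {η₁ η₂ : ℝ} (h0₁ : 0 ≤ η₁) (h0₂ : 0 ≤ η₂)
    (hη₁ : η₁ ≤ 1) (hη₂ : η₂ ≤ 1)
    (h : AlmostQuantumCompatible (noisyId η₁) (noisyId η₂)) :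
    η₁ ^ 2 + η₂ ^ 2 + (1 - η₁ - η₂) ^ 2 ≤ 1 := by
  obtain ⟨-, Ψ, Θ₁, Θ₂, hΨ, hΘ₁, hΘ₂, hJ⟩ := h
  by_contra! hlt
  -- The coefficients `c₁ = 2η₁ + η₂ - 1` and `c₂ = 2η₂ + η₁ - 1` are half the gradient of the left
  -- side of the goal. With them `marginal_bound` reads `Q ≤ √Q`, while `Q - 1` is `3/2` times the
  -- excess of that side over `1`.
  have h₁ : 0 ≤ 2 * η₁ + η₂ - 1 := by
    by_contra!
    nlinarith
  have h₂ : 0 ≤ 2 * η₂ + η₁ - 1 := by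
    by_contra!
    nlinarith
  obtain ⟨Q, hQ⟩ : ∃ Q, Q = (2 * η₁ + η₂ - 1) ^ 2 + (2 * η₂ + η₁ - 1) ^ 2 -
    (2 * η₁ + η₂ - 1) * (2 * η₂ + η₁ - 1) := ⟨_, rfl⟩
  have hQ1 : 1 < Q := by
    rw [hQ]
    linarith
  have hs := Real.sqrt_pos.2 (one_pos.trans hQ1)
  have hs2 := Real.sq_sqrt (one_pos.trans hQ1).le
  have hs1 : 1 < √Q := by
    rw [Real.lt_sqrt zero_le_one]
    linarith
  have hb := marginal_bound hΨ.2 hΘ₁ hΘ₂ hJ.2 h₁ h₂ hs (hs2.trans hQ)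
  have e : (2 * η₁ + η₂ - 1) * (3 * η₁ + 1) + (2 * η₂ + η₁ - 1) * (3 * η₂ + 1) =
      2 * (2 * η₁ + η₂ - 1 + (2 * η₂ + η₁ - 1)) + 2 * Q := by
    rw [hQ]
    ring
  nlinarith

/-! ### A min-tensor-compatible pair -/

theorem posSemidef_fin_two_of_le {P : Op (Fin 2)} {a d : ℝ} (h00 : P 0 0 = a) (h11 : P 1 1 = d)
    (h10 : P 1 0 = star (P 0 1)) (htr : 0 ≤ a + d) (hdet : Complex.normSq (P 0 1) ≤ a * d) :
    P.PosSemidef := by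
  have had := (Complex.normSq_nonneg _).trans hdet
  have ha : 0 ≤ a := by
    by_contra h
    nlinarith
  have hd : 0 ≤ d := by
    by_contra h
    nlinarith
  obtain ⟨r₀, r₁, q, e₀, e₁, e₂⟩ := exists_kraus_of_mul_le ha hd hdet
  have e : P = (!![r₀, r₁; 0, q] : Op (Fin 2)).conjTranspose * !![r₀, r₁; 0, q] := by
    have e₁' := congrArg star e₁
    simp only [star_mul', star_star] at e₁'
    ext i j
    fin_cases i <;> fin_cases j <;>
      simp only [Matrix.mul_apply, Matrix.conjTranspose_apply, Fin.sum_univ_two] <;> simp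
    · rw [h00, ← e₀]; simp
    · rw [← e₁]; simp
    · rw [h10, ← e₁']; simp [mul_comm]
    · rw [h11, ← e₂]; simp
  rw [e]
  exact Matrix.posSemidef_conjTranspose_mul_self _

/-- With `t = x₀y₀` and `c = x · y`, the squared length of `y₀ x + x₀ y` is at most `2t² + 2tc`, and
`(t + c/2)² - (2t² + 2tc)/2 = c²/4`. Thus any factor up to `1/√2` could replace `7/10`. -/
theorem bloch_inequality {x₀ x₁ x₂ x₃ y₀ y₁ y₂ y₃ : ℝ} (hx₀ : 0 ≤ x₀) (hy₀ : 0 ≤ y₀)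
    (hx : x₁ ^ 2 + x₂ ^ 2 + x₃ ^ 2 ≤ x₀ ^ 2) (hy : y₁ ^ 2 + y₂ ^ 2 + y₃ ^ 2 ≤ y₀ ^ 2) :
    0 ≤ x₀ * y₀ + (x₁ * y₁ + x₂ * y₂ + x₃ * y₃) / 2 ∧
      (7 / 10) ^ 2 * ((y₀ * x₁ + x₀ * y₁) ^ 2 + (y₀ * x₂ + x₀ * y₂) ^ 2 +
        (y₀ * x₃ + x₀ * y₃) ^ 2) ≤ (x₀ * y₀ + (x₁ * y₁ + x₂ * y₂ + x₃ * y₃) / 2) ^ 2 := by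
  have hcs : (x₁ * y₁ + x₂ * y₂ + x₃ * y₃) ^ 2 ≤
      (x₁ ^ 2 + x₂ ^ 2 + x₃ ^ 2) * (y₁ ^ 2 + y₂ ^ 2 + y₃ ^ 2) := by
    nlinarith [sq_nonneg (x₁ * y₂ - x₂ * y₁), sq_nonneg (x₁ * y₃ - x₃ * y₁),
      sq_nonneg (x₂ * y₃ - x₃ * y₂)]
  have hcs' : (x₁ * y₁ + x₂ * y₂ + x₃ * y₃) ^ 2 ≤ (x₀ * y₀) ^ 2 := by
    rw [mul_pow]
    exact hcs.trans (mul_le_mul hx hy (by positivity) (by positivity))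
  have ht : 0 ≤ x₀ * y₀ := mul_nonneg hx₀ hy₀
  have hb := abs_le_of_sq_le_sq' hcs' ht
  have hx' := mul_le_mul_of_nonneg_left hx (sq_nonneg y₀)
  have hy' := mul_le_mul_of_nonneg_left hy (sq_nonneg x₀)
  generalize hc : x₁ * y₁ + x₂ * y₂ + x₃ * y₃ = c at *
  have e : (y₀ * x₁ + x₀ * y₁) ^ 2 + (y₀ * x₂ + x₀ * y₂) ^ 2 + (y₀ * x₃ + x₀ * y₃) ^ 2 ≤
      2 * (x₀ * y₀) ^ 2 + 2 * (x₀ * y₀) * c := by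
    rw [← hc]
    linarith
  refine ⟨by linarith [hb.1], ?_⟩
  nlinarith [sq_nonneg (x₀ * y₀ + c), sq_nonneg c, sq_nonneg (x₀ * y₀)]

theorem posSemidef_covariantJointMap_kronecker {F G : Op (Fin 2)} (hF : F.PosSemidef)
    (hG : G.PosSemidef) :
    (covariantJointMap (1 / 10) (1 / 10) (1 / 4) (1 / 40) (F ⊗ₖ G)).PosSemidef := by
  obtain ⟨f10, f00, f11, hf0, hf1, hf⟩ := hF.fin_two
  obtain ⟨g10, g00, g11, hg0, hg1, hg⟩ := hG.fin_two
  generalize (F 0 0).re = f₀ at *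
  generalize (F 1 1).re = f₁ at *
  generalize (G 0 0).re = g₀ at *
  generalize (G 1 1).re = g₁ at *
  obtain ⟨b, hb⟩ : ∃ b, F 0 1 = b := ⟨_, rfl⟩
  obtain ⟨d, hd⟩ : ∃ d, G 0 1 = d := ⟨_, rfl⟩
  rw [hb] at f10 hf
  rw [hd] at g10 hg
  obtain ⟨b₁, b₂⟩ := b
  obtain ⟨d₁, d₂⟩ := d
  rw [Complex.normSq_mk] at hf hg
  -- Bloch coordinates of `F` and `G`, up to the sign of the second component. The image has scalar
  -- part `T` and third component `S`.
  obtain ⟨h₁, h₂⟩ := bloch_inequality (x₀ := (f₀ + f₁) / 2) (x₁ := b₁) (x₂ := b₂)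
    (x₃ := (f₀ - f₁) / 2) (y₀ := (g₀ + g₁) / 2) (y₁ := d₁) (y₂ := d₂) (y₃ := (g₀ - g₁) / 2)
    (by linarith) (by linarith) (by linarith) (by linarith)
  obtain ⟨T, hT⟩ : ∃ T, T = (f₀ + f₁) / 2 * ((g₀ + g₁) / 2) +
    (b₁ * d₁ + b₂ * d₂ + (f₀ - f₁) / 2 * ((g₀ - g₁) / 2)) / 2 := ⟨_, rfl⟩
  rw [← hT] at h₁ h₂
  obtain ⟨S, hS⟩ : ∃ S, S = 7 / 10 * ((g₀ + g₁) / 2 * ((f₀ - f₁) / 2) +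
    (f₀ + f₁) / 2 * ((g₀ - g₁) / 2)) := ⟨_, rfl⟩
  have h01 : covariantJointMap (1 / 10) (1 / 10) (1 / 4) (1 / 40) (F ⊗ₖ G) 0 1 =
      ⟨7 / 10 * ((g₀ + g₁) / 2 * b₁ + (f₀ + f₁) / 2 * d₁),
        7 / 10 * ((g₀ + g₁) / 2 * b₂ + (f₀ + f₁) / 2 * d₂)⟩ := by
    rw [covariantJointMap_kronecker]
    apply Complex.ext <;>
      simp [Matrix.mul_apply, Matrix.trace, Fin.sum_univ_two, f00, f11, g00, g11, hb, hd] <;> ring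
  have h10 : covariantJointMap (1 / 10) (1 / 10) (1 / 4) (1 / 40) (F ⊗ₖ G) 1 0 =
      ⟨7 / 10 * ((g₀ + g₁) / 2 * b₁ + (f₀ + f₁) / 2 * d₁),
        -(7 / 10 * ((g₀ + g₁) / 2 * b₂ + (f₀ + f₁) / 2 * d₂))⟩ := by
    rw [covariantJointMap_kronecker]
    apply Complex.ext <;>
      simp [Matrix.mul_apply, Matrix.trace, Fin.sum_univ_two, f00, f11, g00, g11, f10, g10] <;>
        ring
  refine posSemidef_fin_two_of_le (a := T + S) (d := T - S) ?_ ?_ ?_ (by linarith) ?_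
  · rw [covariantJointMap_kronecker, hT, hS]
    apply Complex.ext <;>
      simp [Matrix.mul_apply, Matrix.trace, Fin.sum_univ_two, f00, f11, g00, g11, f10, g10, hb,
        hd] <;> ring
  · rw [covariantJointMap_kronecker, hT, hS]
    apply Complex.ext <;>
      simp [Matrix.mul_apply, Matrix.trace, Fin.sum_univ_two, f00, f11, g00, g11, f10, g10, hb,
        hd] <;> ring
  · rw [h01, h10]
    rfl
  · rw [h01, Complex.normSq_mk]
    rw [hS]
    linarith

theorem minTensorCompatible_noisyId :
    MinTensorCompatible (noisyId (7 / 10)) (noisyId (7 / 10)) := by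
  -- Here `g = 1/4` produces the term `c/2` of `bloch_inequality`; the marginals and unitality then
  -- fix the other coefficients.
  refine ⟨covariantJointMap (1 / 10) (1 / 10) (1 / 4) (1 / 40), ?_,
    hasMarginals_covariantJointMap (by norm_num) (by norm_num) (by norm_num)⟩
  rintro E ⟨-, N, w, F, G, hw, hF, hG, rfl⟩
  rw [map_sum]
  refine Matrix.posSemidef_sum _ fun n _ => ?_
  rw [map_smul]
  exact (posSemidef_covariantJointMap_kronecker (hF n) (hG n)).smul
    (Complex.zero_le_real.2 (hw n))

end QChannel

end

/-! ### The theorem. -/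

theorem theorem2 :
    (∀ η₁ η₂ : ℝ, η₁ ∈ Set.Icc (0 : ℝ) 1 → η₂ ∈ Set.Icc (0 : ℝ) 1 →
      (QChannel.AlmostQuantumCompatible (QChannel.noisyId η₁) (QChannel.noisyId η₂) ↔
        η₁ ^ 2 + η₂ ^ 2 + (1 - η₁ - η₂) ^ 2 ≤ 1)) ∧
    (∀ η₁ η₂ : ℝ, η₁ ∈ Set.Icc (0 : ℝ) 1 → η₂ ∈ Set.Icc (0 : ℝ) 1 →
      (QChannel.AlmostQuantumCompatible (QChannel.noisyId η₁) (QChannel.noisyId η₂) ↔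
        QChannel.QuantumCompatible (QChannel.noisyId η₁) (QChannel.noisyId η₂))) ∧
    {η : ℝ × ℝ | η.1 ∈ Set.Icc (0 : ℝ) 1 ∧ η.2 ∈ Set.Icc (0 : ℝ) 1 ∧
        QChannel.AlmostQuantumCompatible (QChannel.noisyId η.1) (QChannel.noisyId η.2)} ⊂
      {η : ℝ × ℝ | η.1 ∈ Set.Icc (0 : ℝ) 1 ∧ η.2 ∈ Set.Icc (0 : ℝ) 1 ∧
        QChannel.MinTensorCompatible (QChannel.noisyId η.1) (QChannel.noisyId η.2)} := by
  refine ⟨fun η₁ η₂ h₁ h₂ => ⟨fun h => h.le_one h₁.1 h₂.1 h₁.2 h₂.2, fun h =>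
    (QChannel.quantumCompatible_noisyId_of_le h₂.2 h).almostQuantumCompatible⟩,
    fun η₁ η₂ h₁ h₂ => ⟨fun h => QChannel.quantumCompatible_noisyId_of_le h₂.2
      (h.le_one h₁.1 h₂.1 h₁.2 h₂.2), fun h => h.almostQuantumCompatible⟩,
    Set.ssubset_iff_subset_ne.2 ⟨fun η h => ⟨h.1, h.2.1, h.2.2.1⟩, fun he => ?_⟩⟩
  -- On the diagonal the ellipse ends at `2/3`, and the Bloch estimate reaches `1/√2`; `7/10` lies
  -- between.
  have hmem : ((7 / 10 : ℝ), (7 / 10 : ℝ)) ∈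
      {η : ℝ × ℝ | η.1 ∈ Set.Icc (0 : ℝ) 1 ∧ η.2 ∈ Set.Icc (0 : ℝ) 1 ∧
        QChannel.MinTensorCompatible (QChannel.noisyId η.1) (QChannel.noisyId η.2)} :=
    ⟨⟨by norm_num, by norm_num⟩, ⟨by norm_num, by norm_num⟩,
      QChannel.minTensorCompatible_noisyId⟩
  rw [← he] at hmem
  have h := hmem.2.2.le_one (by norm_num) (by norm_num) (by norm_num) (by norm_num)
  norm_num at h
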